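/- Let $p$ be a prime, $\mathbb F_q$ a finite field of characteristic $p$, and $V$ a vector space of finite dimension $n$ over $\mathbb F_q$. A transvection of $V$ is a map $1+u\otimes\phi\in\mathrm{SL}(V)$, $x\mapsto x+\phi(x)u$, with $0\ne u\in V$, $0\ne\phi\in V^*$ and $\phi(u)=0$. For a transvection $t=1+u\otimes\phi$, a scalar $\lambda\in\mathbb F_q^\times$ and a subset $\Lambda\subseteq\mathbb F_q^\times$ put $t^\lambda:=1+\lambda u\otimes\phi$ and $t^\Lambda:=\{t^\lambda\mid\lambda\in\Lambda\}$. For transvections $s=1+u\otimes\phi$ and $t=1+v\otimes\psi$ let $w(s,t):=\psi(u)\phi(v)$, and call $(s,t)$ a two-way directed edge if $\psi(u)\neq0$ and $\phi(v)\ne0$. (These notions depend only on the transvections, not on the chosen vectors and forms.) Theorem. Let $(s,t)$ be a two-way directed edge of transvections of $V$, let $K,\Lambda\subseteq\mathbb F_q^\times$ be subsets containing $1$, and let $M:=\mathbb F_p(K,\Lambda,w(s,t))$ be the subfield of $\mathbb F_q$ generated by $K$, $\Lambda$ and $w(s,t)$. If $p\ne2$ and $|M|\neq 9$, then $$\langle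 s^K,t^\Lambda\rangle\simeq \mathrm{SL}(2,M)\oplus 1_{n-2},$$ that is, there are a direct sum decomposition $V=U\oplus W$ with $\dim U=2$ and a basis of $U$ such that $\langle s^K,t^\Lambda\rangle$ is exactly the set of those $g\in\mathrm{SL}(V)$ that map $U$ to $U$, fix every vector of $W$, and whose restriction to $U$ has, in that basis, a matrix in $\mathrm{SL}(2,M)$. -/

import Mathlib

namespace TransvectionGraph

open Module

section Transvections

variable {F V : Type*} [Field F] [AddCommGroup V] [Module F V] [FiniteDimensional F V]

set_option linter.unusedSectionVars false

/-- The element `1 + u ⊗ φ` of `SL(V)`, i.e. `x ↦ x + φ x • u`, for a vector `u` and a linear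
form `φ` with `φ u = 0`. -/
def ofVecForm (u : V) (φ : Dual F V) (h : φ u = 0) : SpecialLinearGroup F V :=
  ⟨LinearEquiv.transvection h, LinearEquiv.transvection.det_eq_one h⟩

theorem ofVecForm_apply (u : V) (φ : Dual F V) (h : φ u = 0) (x : V) :
    (ofVecForm u φ h).1 x = x + φ x • u := rfl

variable (F V) in
/-- The set of all transvections of `SL(V)`: the maps `1 + u ⊗ φ` with `u ≠ 0`, `φ ≠ 0` and
`φ u = 0`. -/
def transvections : Set (SpecialLinearGroup F V) :=
  {t | ∃ (u : V) (φ : Dual F V) (h : φ u = 0), u ≠ 0 ∧ φ ≠ 0 ∧ t = ofVecForm u φ h}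

/-- A fixed choice of the vector `u` in a representation `t = 1 + u ⊗ φ`. -/
noncomputable def vec (t : transvections F V) : V := t.2.choose

/-- The linear form `φ` that goes with the fixed choice of `u` in `t = 1 + u ⊗ φ`. -/
noncomputable def form (t : transvections F V) : Dual F V := t.2.choose_spec.choose

theorem form_vec (t : transvections F V) : form t (vec t) = 0 :=
  t.2.choose_spec.choose_spec.choose

theorem vec_ne_zero (t : transvections F V) : vec t ≠ 0 :=
  t.2.choose_spec.choose_spec.choose_spec.1

theorem form_ne_zero (t : transvections F V) : form t ≠ 0 :=
  t.2.choose_spec.choose_spec.choose_spec.2.1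

theorem coe_eq (t : transvections F V) :
    (t : SpecialLinearGroup F V) = ofVecForm (vec t) (form t) (form_vec t) :=
  t.2.choose_spec.choose_spec.choose_spec.2.2

/-- The label `l(s,t) = φ_t(u_s)` in the labelled transvection graph. -/
noncomputable def label (s t : transvections F V) : F := form t (vec s)

/-- There is a directed edge from `s = 1 + u ⊗ φ` to `t = 1 + v ⊗ ψ` iff `ψ u ≠ 0`. -/
def IsEdge (s t : transvections F V) : Prop := label s t ≠ 0

/-- `(s,t)` is a two-way directed edge: there are edges in both directions. -/
def IsTwoWayEdge (s t : transvections F V) : Prop := IsEdge s t ∧ IsEdge t s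

/-- The weight `w(s,t) = l(s,t) l(t,s)` of a pair of transvections. -/
noncomputable def weight (s t : transvections F V) : F := label s t * label t s

/-- For `t = 1 + u ⊗ φ` and a scalar `c`, the element `t^c = 1 + c u ⊗ φ` of `SL(V)`. -/
noncomputable def scalarPow (t : transvections F V) (c : F) : SpecialLinearGroup F V :=
  ofVecForm (c • vec t) (form t) (by simp [form_vec])

/-- The set `t^Λ = {t^c | c ∈ Λ}` for a set `Λ` of nonzero scalars. -/
noncomputable def scalarPowSet (t : transvections F V) (Λ : Set Fˣ) :
    Set (SpecialLinearGroup F V) :=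
  (fun c : Fˣ => scalarPow t (c : F)) '' Λ

theorem form_smul_vec (t : transvections F V) {u : V} {φ : Dual F V} {h : φ u = 0}
    (ht : (t : SpecialLinearGroup F V) = ofVecForm u φ h) (x : V) :
    form t x • vec t = φ x • u := by
  have h1 := congrArg (fun g : SpecialLinearGroup F V => g.1 x) ((coe_eq t).symm.trans ht)
  simpa [ofVecForm_apply] using h1

/-- The weight does not depend on the chosen vectors and forms. -/
theorem weight_eq (s t : transvections F V) {u v : V} {φ ψ : Dual F V} {hu : φ u = 0}
    {hv : ψ v = 0} (hs : (s : SpecialLinearGroup F V) = ofVecForm u φ hu)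
    (ht : (t : SpecialLinearGroup F V) = ofVecForm v ψ hv) :
    weight s t = ψ u * φ v := by
  have h1 := congrArg (form t) (form_smul_vec s hs (vec t))
  have h2 := congrArg φ (form_smul_vec t ht u)
  simp only [map_smul, smul_eq_mul] at h1 h2
  unfold weight label
  rw [mul_comm, h1, mul_comm, h2]

/-- The edges do not depend on the chosen vectors and forms. -/
theorem isEdge_iff (s t : transvections F V) {u v : V} {φ ψ : Dual F V} {hu : φ u = 0}
    {hv : ψ v = 0} (hs : (s : SpecialLinearGroup F V) = ofVecForm u φ hu)
    (ht : (t : SpecialLinearGroup F V) = ofVecForm v ψ hv) (hφ : φ ≠ 0) (hv0 : v ≠ 0) :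
    IsEdge s t ↔ ψ u ≠ 0 := by
  obtain ⟨x, hx⟩ : ∃ x, φ x ≠ 0 := by
    by_contra hc
    push Not at hc
    exact hφ (LinearMap.ext hc)
  obtain ⟨y, hy⟩ : ∃ y, form s y ≠ 0 := by
    by_contra hc
    push Not at hc
    exact form_ne_zero s (LinearMap.ext hc)
  have h1 := congrArg (form t) (form_smul_vec s hs x)
  have h2 := congrArg (form t) (form_smul_vec s hs y)
  have h3 := form_smul_vec t ht u
  simp only [map_smul, smul_eq_mul] at h1 h2
  unfold IsEdge label
  constructor
  · intro h h0
    rw [h0, zero_smul] at h3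
    rcases smul_eq_zero.1 h3 with h4 | h4
    · rw [h4, mul_zero] at h2
      exact (mul_ne_zero hy h) h2
    · exact vec_ne_zero t h4
  · intro h h0
    rw [h0, mul_zero] at h1
    rcases mul_eq_zero.1 h1.symm with h4 | h4
    · exact hx h4
    · rw [h4, zero_smul] at h3
      exact (smul_ne_zero h hv0) h3.symm

/-- The power `t^c` does not depend on the chosen vector and form. -/
theorem scalarPow_apply (t : transvections F V) {u : V} {φ : Dual F V} {h : φ u = 0}
    (ht : (t : SpecialLinearGroup F V) = ofVecForm u φ h) (c : F) (x : V) :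
    (scalarPow t c).1 x = x + φ x • c • u := by
  unfold scalarPow
  rw [ofVecForm_apply, smul_comm, form_smul_vec t ht, smul_comm]

end Transvections

section DirectSum

variable {F V : Type*} [Field F] [AddCommGroup V] [Module F V]

/-- For subspaces `U`, `W` of `V` and a subgroup `H₀` of `SL(U)`, the subgroup `H₀ ⊕ 1_W` of
`SL(V)`: the elements that restrict to an element of `H₀` on `U` and to the identity on `W`
(so that they map `U` onto `U` and `W` onto `W`). It is used for `V = U ⊕ W`. -/
def sumOne (U W : Submodule F V) (H₀ : Subgroup (SpecialLinearGroup F U)) :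
    Subgroup (SpecialLinearGroup F V) where
  carrier := {g | (∃ h ∈ H₀, ∀ u : U, g.1 (u : V) = ((h.1 u : U) : V)) ∧ ∀ w ∈ W, g.1 w = w}
  one_mem' := ⟨⟨1, H₀.one_mem, fun _ => rfl⟩, fun _ _ => rfl⟩
  mul_mem' := by
    rintro a b ⟨⟨h, hh, ha⟩, ha'⟩ ⟨⟨k, hk, hb⟩, hb'⟩
    refine ⟨⟨h * k, H₀.mul_mem hh hk, fun u => ?_⟩, fun w hw => ?_⟩
    · change a.1 (b.1 (u : V)) = ((h.1 (k.1 u) : U) : V)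
      rw [hb, ha]
    · change a.1 (b.1 w) = w
      rw [hb' w hw, ha' w hw]
  inv_mem' := by
    rintro a ⟨⟨h, hh, ha⟩, ha'⟩
    refine ⟨⟨h⁻¹, H₀.inv_mem hh, fun u => ?_⟩, fun w hw => ?_⟩
    · change a.1.symm (u : V) = ((h.1.symm u : U) : V)
      rw [LinearEquiv.symm_apply_eq, ha]
      exact congrArg Subtype.val (h.1.apply_symm_apply u).symm
    · change a.1.symm w = w
      rw [LinearEquiv.symm_apply_eq, ha' w hw]

/-- The relation `H ≃ N ⊕ 1_{n-k}` between a subgroup `H` of `SL(V)` and a subgroup `N` of the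
matrix group `SL(k,F)`, where `n = dim V`: there are a decomposition `V = U ⊕ W` with `dim U = k`
and a subgroup `H₀` of `SL(U)` such that `H = H₀ ⊕ 1_W` and, in a suitable basis of `U`, the
matrices of the elements of `H₀` are exactly the elements of `N`. -/
def IsSumOne (k : ℕ) (H : Subgroup (SpecialLinearGroup F V))
    (N : Subgroup (Matrix.SpecialLinearGroup (Fin k) F)) : Prop :=
  ∃ U W : Submodule F V, IsCompl U W ∧ finrank F U = k ∧
    ∃ H₀ : Subgroup (SpecialLinearGroup F U), H = sumOne U W H₀ ∧
      ∃ b : Basis (Fin k) F U,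
        H₀.map (Matrix.SpecialLinearGroup.toLin_equiv b).symm.toMonoidHom = N

/-- `SL(k,M)` as a subgroup of `SL(k,F)` for a subfield `M` of `F`: the matrices of determinant
one all of whose entries lie in `M`. -/
def slSubfield (k : ℕ) (M : Subfield F) : Subgroup (Matrix.SpecialLinearGroup (Fin k) F) :=
  (Matrix.SpecialLinearGroup.map (n := Fin k) M.subtype).range

/-- The subfield `𝔽_p(K, Λ, δ)` of `F` generated by `K`, `Λ` and `δ` over the prime field. -/
def genSubfield (K Λ : Set Fˣ) (δ : F) : Subfield F :=
  Subfield.closure ((fun c : Fˣ => (c : F)) '' K ∪ (fun c : Fˣ => (c : F)) '' Λ ∪ {δ})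

end DirectSum

end TransvectionGraph

/-! Write s = 1+u⊗φ and t = 1+v⊗ψ. Both groups act trivially on ker φ ∩ ker ψ, and in the basis u,
φ(v)⁻¹v of a complementary plane s^c and t^c become `upper c` and `lower (c * w)` with w = w(s,t).
The group G generated by these matrices lies in SL(2,M). Conversely, it suffices that the a with
`upper a` ∈ G and those with `lower a` ∈ G form one and the same subfield R: then R contains w, K
and Λw, hence M, and the elementary matrices over M generate SL(2,M).

To find R, argue as in Dickson's theorem (`finiteOrbit_eq_or`). Over an algebraic closure, adjoin -1
and let G act on the projective line. An element other than ±1 fixes one or two points, and the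
points that are the only fixed point of some element form the orbit of ∞. If A = {a | `upper a` ∈ G}
has q elements, this orbit has 1+mq points. Burnside counting leaves exactly one more orbit of
points with a stabilizer larger than ±1, and comparing orbit lengths gives an equation with the
solutions m = 1 and one exception, q = m = 3, where the group has the order 120 of SL(2,5).

If m = 1, the finite points of the orbit of ∞ are A itself. An element of G that swaps 0 and ∞ makes
A stable under a ↦ θ/a, and Hua's identity makes A a field (`exists_subfield_of_div_mem`). In the
exceptional case p = 3 and the stabilizer orders 12 and 10 force every trace to satisfy x^9 = x. As
`upper x * lower y` has trace 2+xy, all elements of M satisfy this too, so |M| ≠ 9 leaves M = 𝔽₃,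
and there `upper 1` and `lower (±1)` generate SL(2,M). -/

namespace TransvectionGraph

/-! ### Burnside counting modulo a central involution -/

section OrbitCounting

open MulAction

variable {G X : Type*} [Group G] [MulAction G X]

/-- The points fixed by some element outside the central pair `{1, z}`. -/
def specialPoints (X : Type*) [MulAction G X] (z : G) (hz : ∀ g : G, g * z = z * g) :
    SubMulAction G X where
  carrier := {x | ∃ g : G, g ≠ 1 ∧ g ≠ z ∧ g • x = x}
  smul_mem' := by
    rintro h x ⟨g, h1, h2, h3⟩
    refine ⟨h * g * h⁻¹, fun h4 => h1 ?_, fun h4 => h2 ?_, ?_⟩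
    · simpa using h4
    · rw [mul_inv_eq_iff_eq_mul, ← hz] at h4
      exact mul_left_cancel h4
    · rw [mul_smul, inv_smul_smul, mul_smul, h3]

theorem card_orbit_mul_card_stabilizer (x : X) :
    Nat.card (orbit G x) * Nat.card (stabilizer G x) = Nat.card G := by
  rw [← Nat.card_prod, Nat.card_congr (orbitProdStabilizerEquivGroup G x)]

theorem two_dvd_card_stabilizer {z : G} (hz1 : z ≠ 1) (hzz : z * z = 1)
    (hzX : ∀ x : X, z • x = x) (x : X) : 2 ∣ Nat.card (stabilizer G x) := by
  have h : orderOf (⟨z, hzX x⟩ : stabilizer G x) = 2 :=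
    orderOf_eq_prime (by ext; simp [pow_two, hzz]) (by simpa [Subtype.ext_iff] using hz1)
  exact h ▸ orderOf_dvd_natCard _

theorem exists_card_stabilizer_eq [Finite G] {z : G} (hz1 : z ≠ 1) (hzz : z * z = 1)
    (hzX : ∀ x : X, z • x = x) {x : X} {g : G} (hg1 : g ≠ 1) (hgz : g ≠ z) (hgx : g • x = x) :
    ∃ d, 2 ≤ d ∧ Nat.card (stabilizer G x) = 2 * d := by
  obtain ⟨d, hd⟩ := two_dvd_card_stabilizer hz1 hzz hzX x
  refine ⟨d, ?_, hd⟩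
  have h3 : 2 < Nat.card (stabilizer G x) := by
    have h : ({1, z, g} : Set G) ⊆ (stabilizer G x : Set G) := by
      rintro y (rfl | rfl | rfl)
      · exact one_mem _
      · exact hzX x
      · exact hgx
    have h2 := Set.ncard_le_ncard h (Set.toFinite _)
    rw [Set.ncard_eq_three.2 ⟨1, z, g, hz1.symm, hg1.symm, hgz.symm, rfl⟩] at h2
    exact h2
  omega

/-- Burnside's lemma on the special points. Every g counts 2, less 1 if it fixes a single point,
while 1 and z fix all special points. Finiteness belongs to the conclusion because X may be
infinite. -/
theorem sum_card_fixedBy_specialPoints [Finite G] {z : G} (hz : ∀ g : G, g * z = z * g)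
    (hz1 : z ≠ 1) (hzX : ∀ x : X, z • x = x)
    (hfix : ∀ g : G, g ≠ 1 → g ≠ z → (fixedBy X g).ncard = 1 ∨ (fixedBy X g).ncard = 2) :
    Finite (specialPoints X z hz) ∧
    2 * (Nat.card (specialPoints X z hz) : ℤ) + 2 * Nat.card G - 4 -
        Nat.card {g : G // g ≠ 1 ∧ g ≠ z ∧ (fixedBy X g).ncard = 1} =
      Nat.card (orbitRel.Quotient G (specialPoints X z hz)) * Nat.card G := by
  classical
  have hfin : Finite (specialPoints X z hz) := by
    have h : ((specialPoints X z hz : SubMulAction G X) : Set X) ⊆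
        ⋃ g ∈ {g : G | g ≠ 1 ∧ g ≠ z}, fixedBy X g := by
      rintro x ⟨g, h1, h2, h3⟩
      simp only [Set.mem_iUnion]
      exact ⟨g, ⟨h1, h2⟩, h3⟩
    refine Set.Finite.subset (Set.Finite.biUnion (Set.toFinite _) fun g hg => ?_) h
    refine Set.finite_of_ncard_ne_zero ?_
    rcases hfix g hg.1 hg.2 with h | h <;> omega
  refine ⟨hfin, ?_⟩
  have := Fintype.ofFinite G
  have := Fintype.ofFinite (specialPoints X z hz)
  have key := sum_card_fixedBy_eq_card_orbits_mul_card_group G (specialPoints X z hz)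
  have hval : ∀ g : G, (Fintype.card (fixedBy (specialPoints X z hz) g) : ℤ) =
      2 - (if g ≠ 1 ∧ g ≠ z ∧ (fixedBy X g).ncard = 1 then 1 else 0)
        + (if g = 1 then ((Nat.card (specialPoints X z hz) : ℤ) - 2) else 0)
        + (if g = z then ((Nat.card (specialPoints X z hz) : ℤ) - 2) else 0) := by
    intro g
    rw [← Nat.card_eq_fintype_card]
    by_cases h1 : g = 1
    · have h : fixedBy (specialPoints X z hz) g = Set.univ := by
        ext x; simp [h1]
      rw [h, Nat.card_congr (Equiv.Set.univ _)]
      simp [h1, hz1.symm]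
    by_cases h2 : g = z
    · have h : fixedBy (specialPoints X z hz) g = Set.univ := by
        ext x; simp [h2, Subtype.ext_iff, hzX]
      rw [h, Nat.card_congr (Equiv.Set.univ _)]
      simp [h2, hz1]
    have h3 : Nat.card (fixedBy (specialPoints X z hz) g) = (fixedBy X g).ncard := by
      refine Nat.card_congr ⟨fun x => ⟨x.1.1, congrArg Subtype.val x.2⟩,
        fun x => ⟨⟨x.1, g, h1, h2, x.2⟩, Subtype.ext x.2⟩, fun _ => rfl, fun _ => rfl⟩
    rw [h3]
    rcases hfix g h1 h2 with h | h <;> simp [h, h1, h2]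
  have key' := congrArg (Nat.cast : ℕ → ℤ) key
  rw [Nat.cast_sum, Nat.cast_mul] at key'
  rw [Finset.sum_congr rfl fun g _ => hval g] at key'
  simp only [Finset.sum_add_distrib, Finset.sum_sub_distrib, Finset.sum_ite_eq', Finset.mem_univ,
    if_true, Finset.sum_const, Finset.card_univ, Finset.sum_boole] at key'
  rw [Nat.card_eq_fintype_card (α := G), Nat.card_eq_fintype_card (α := orbitRel.Quotient _ _),
    Nat.subtype_card (Finset.univ.filter fun g : G => g ≠ 1 ∧ g ≠ z ∧ (fixedBy X g).ncard = 1)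
      (by simp), ← Nat.cast_mul]
  simp only [nsmul_eq_mul] at key'
  push_cast at key' ⊢
  linarith

theorem card_orbit_subMulAction (Y : SubMulAction G X) (y : Y) :
    Nat.card (orbit G y) = Nat.card (orbit G (y : X)) := by
  rw [← SubMulAction.val_image_orbit]
  exact (Nat.card_image_of_injective Subtype.val_injective _).symm

/-- Burnside counting for a group in which every element outside `{1, z}` fixes one or two points,
and those that fix one point fix a point of the orbit of `o`: beside this orbit there is exactly
one further orbit of points that are fixed by an element outside `{1, z}`. -/
theorem exists_card_stabilizer_of_notMem_orbit [Finite G] {z : G} (hz : ∀ g : G, g * z = z * g)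
    (hz1 : z ≠ 1) (hzz : z * z = 1) (hzX : ∀ x : X, z • x = x)
    (hfix : ∀ g : G, g ≠ 1 → g ≠ z → (fixedBy X g).ncard = 1 ∨ (fixedBy X g).ncard = 2)
    {o : X} {q k : ℕ} (hq : 2 ≤ q) (ho : ∃ g : G, g ≠ 1 ∧ g ≠ z ∧ g • o = o)
    (hn : 3 ≤ Nat.card (orbit G o))
    (hpar : Nat.card {g : G // g ≠ 1 ∧ g ≠ z ∧ (fixedBy X g).ncard = 1} =
      Nat.card (orbit G o) * (2 * (q - 1)))
    (hstab : Nat.card (stabilizer G o) = 2 * q * k) :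
    ∃ d, 2 ≤ d ∧ d * (Nat.card (orbit G o) * (q - 2) + 2) = Nat.card (orbit G o) * q * k ∧
      ∀ x ∉ orbit G o, (∃ g : G, g ≠ 1 ∧ g ≠ z ∧ g • x = x) →
        Nat.card (stabilizer G x) = 2 * d := by
  classical
  obtain ⟨hfin, hcount⟩ := sum_card_fixedBy_specialPoints hz hz1 hzX hfix
  set Y := specialPoints X z hz with hY
  set n := Nat.card (orbit G o) with hn'
  have hN : n * (2 * q * k) = Nat.card G := by
    rw [← hstab]; exact card_orbit_mul_card_stabilizer o
  have hNpos : 0 < Nat.card G := Nat.card_pos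
  have hk : 1 ≤ k := by
    rcases Nat.eq_zero_or_pos k with h | h
    · rw [h] at hN; omega
    · exact h
  let y₀ : Y := ⟨o, ho⟩
  let ω₀ : orbitRel.Quotient G Y := Quotient.mk'' y₀
  have := Fintype.ofFinite Y
  have : Fintype (orbitRel.Quotient G Y) := Fintype.ofFinite _
  let f : orbitRel.Quotient G Y → ℕ := fun ω => Nat.card ω.orbit
  have hfmk : ∀ y : Y, f (Quotient.mk'' y) = Nat.card (orbit G (y : X)) := by
    intro y
    rw [← card_orbit_subMulAction]
    rfl
  have hYsum : Nat.card Y = ∑ ω, f ω := by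
    rw [Nat.card_congr (selfEquivSigmaOrbits' G Y), Nat.card_sigma]
  have hf₀ : f ω₀ = n := hfmk y₀
  have hle : ∀ ω, 4 * f ω ≤ Nat.card G := by
    intro ω
    induction ω using Quotient.inductionOn' with
    | h y =>
      obtain ⟨g, h1, h2, h3⟩ := y.2
      obtain ⟨d, hd, hd'⟩ := exists_card_stabilizer_eq hz1 hzz hzX h1 h2 h3
      rw [hfmk, ← card_orbit_mul_card_stabilizer (G := G) (y : X), hd']
      nlinarith [Nat.zero_le (Nat.card (orbit G (y : X)))]
  rw [← Finset.add_sum_erase _ _ (Finset.mem_univ ω₀), hf₀] at hYsum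
  set E := (Finset.univ : Finset (orbitRel.Quotient G Y)).erase ω₀ with hE
  have hR : Nat.card (orbitRel.Quotient G Y) = E.card + 1 := by
    rw [hE, Finset.card_erase_of_mem (Finset.mem_univ _), Finset.card_univ,
      Nat.card_eq_fintype_card]
    have : 0 < Fintype.card (orbitRel.Quotient G Y) := Fintype.card_pos_iff.2 ⟨ω₀⟩
    omega
  have hsumle : 4 * ∑ ω ∈ E, f ω ≤ E.card * Nat.card G := by
    rw [Finset.mul_sum, ← smul_eq_mul]
    exact Finset.sum_le_card_nsmul _ _ _ fun ω _ => hle ω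
  rw [hpar, hR, hYsum] at hcount
  obtain ⟨q', rfl⟩ : ∃ q', q = q' + 2 := ⟨q - 2, by omega⟩
  simp only [Nat.add_sub_cancel, show q' + 2 - 1 = q' + 1 by omega] at hcount ⊢
  -- With no further orbit the count reads n(1+qk-(q-1)) = 2, against n ≥ 3. With e ≥ 2 further
  -- orbits, each of length at most |G|/4, it gives (1-e/2)|G| ≥ 2n(q-2)+4 > 0.
  have hone : E.card = 1 := by
    rcases Nat.lt_trichotomy E.card 1 with h | h | h
    · exfalso
      have h0 : E.card = 0 := by omega
      rw [Finset.card_eq_zero] at h0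
      rw [h0, ← hN] at hcount
      simp only [Finset.sum_empty, Finset.card_empty] at hcount
      push_cast at hcount
      have h5 : (n : ℤ) * (1 + (q' + 2) * k - (q' + 1)) = 2 := by linarith
      have h6 : (1 + (q' + 2) * k - (q' + 1) : ℤ) ≥ 2 := by
        have : (1 : ℤ) ≤ k := mod_cast hk
        nlinarith
      have : (3 : ℤ) ≤ n := mod_cast hn
      nlinarith
    · exact h
    · exfalso
      zify at hsumle hN hNpos h hn
      push_cast at hcount
      nlinarith [mul_nonneg (Nat.cast_nonneg n : (0:ℤ) ≤ n) (Nat.cast_nonneg q' : (0:ℤ) ≤ q')]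
  obtain ⟨ω₁, hω₁⟩ := Finset.card_eq_one.1 hone
  rw [hone, hω₁, Finset.sum_singleton] at hcount
  have hf₁ : f ω₁ = n * q' + 2 := by
    zify
    push_cast at hcount
    linarith
  have hall : ∀ y : Y, (y : X) ∉ orbit G o → Nat.card (orbit G (y : X)) = n * q' + 2 := by
    intro y hy
    have h1 : Quotient.mk'' y ∈ E := by
      refine Finset.mem_erase.2 ⟨fun h => hy ?_, Finset.mem_univ _⟩
      have h2 : y ∈ orbit G y₀ := Quotient.exact' h
      exact SubMulAction.mem_orbit_subMul_iff.1 h2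
    rw [hω₁, Finset.mem_singleton] at h1
    rw [← hfmk, h1, hf₁]
  obtain ⟨y₁, hy₁⟩ := Quotient.exists_rep ω₁
  have hy₁o : (y₁ : X) ∉ orbit G o := by
    intro h
    have h1 : ω₁ ∈ E := by rw [hω₁]; simp
    refine (Finset.mem_erase.1 h1).1 ?_
    rw [← hy₁]
    refine Quotient.sound' ?_
    change y₁ ∈ orbit G y₀
    exact SubMulAction.mem_orbit_subMul_iff.2 h
  obtain ⟨g, h1, h2, h3⟩ := y₁.2
  obtain ⟨d, hd, hd'⟩ := exists_card_stabilizer_eq hz1 hzz hzX h1 h2 h3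
  have hprod := card_orbit_mul_card_stabilizer (G := G) (y₁ : X)
  rw [hall y₁ hy₁o, hd', ← hN] at hprod
  refine ⟨d, hd, by linarith, fun x hx hgx => ?_⟩
  have hprod' := card_orbit_mul_card_stabilizer (G := G) x
  rw [hall ⟨x, hgx⟩ hx, ← hN, ← hprod] at hprod'
  exact Nat.eq_of_mul_eq_mul_left (by omega) hprod'

theorem ncard_fixedBy_conj (h g : G) :
    (fixedBy X (h * g * h⁻¹)).ncard = (fixedBy X g).ncard := by
  rw [← smul_fixedBy]
  exact Set.ncard_image_of_injective _ (MulAction.injective h)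

/-- Each such element lies over the one point it fixes, which is in the orbit of o, and conjugation
makes all fibres equally large. -/
theorem card_setOf_ncard_fixedBy_eq_one [Finite G] {z : G} (hz : ∀ g : G, g * z = z * g) (o : X)
    (hpar : ∀ g : G, g ≠ 1 → g ≠ z → (fixedBy X g).ncard = 1 → fixedBy X g ⊆ orbit G o) :
    Nat.card {g : G // g ≠ 1 ∧ g ≠ z ∧ (fixedBy X g).ncard = 1} =
      Nat.card (orbit G o) *
        Nat.card {g : G // (g ≠ 1 ∧ g ≠ z ∧ (fixedBy X g).ncard = 1) ∧ g • o = o} := by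
  set par : G → Prop := fun g => g ≠ 1 ∧ g ≠ z ∧ (fixedBy X g).ncard = 1 with hp
  have hconj : ∀ h g, par g → par (h * g * h⁻¹) := by
    rintro h g ⟨h1, h2, h3⟩
    refine ⟨fun h4 => h1 (by simpa using h4), fun h4 => h2 ?_, by rwa [ncard_fixedBy_conj]⟩
    rw [mul_inv_eq_iff_eq_mul, ← hz] at h4
    exact mul_left_cancel h4
  have : Finite (orbit G o) := Set.finite_range _
  have := Fintype.ofFinite (orbit G o)
  have hbij : Function.Bijective
      (fun y : (Σ x : orbit G o, {g : G // par g ∧ g • (x : X) = x}) =>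
        (⟨y.2.1, y.2.2.1⟩ : {g : G // par g})) := by
    constructor
    · rintro ⟨⟨x, hx⟩, g, hg, hgx⟩ ⟨⟨x', hx'⟩, g', hg', hgx'⟩ h
      obtain rfl : g = g' := congrArg Subtype.val h
      obtain ⟨y, hy⟩ := Set.ncard_eq_one.1 hg.2.2
      have h1 : x ∈ fixedBy X g := hgx
      have h2 : x' ∈ fixedBy X g := hgx'
      rw [hy, Set.mem_singleton_iff] at h1 h2
      subst h1 h2
      rfl
    · rintro ⟨g, hg⟩
      obtain ⟨y, hy⟩ := Set.ncard_eq_one.1 hg.2.2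
      have h1 : y ∈ fixedBy X g := by rw [hy]; rfl
      exact ⟨⟨⟨y, hpar g hg.1 hg.2.1 hg.2.2 h1⟩, g, hg, h1⟩, rfl⟩
  have hfib : ∀ x : orbit G o, Nat.card {g : G // par g ∧ g • (x : X) = x} =
      Nat.card {g : G // par g ∧ g • o = o} := by
    rintro ⟨-, h, rfl⟩
    refine Nat.card_congr ⟨fun g => ⟨h⁻¹ * g.1 * h, ?_, ?_⟩, fun g => ⟨h * g.1 * h⁻¹, ?_, ?_⟩,
      fun g => ?_, fun g => ?_⟩
    · simpa using hconj h⁻¹ g.1 g.2.1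
    · have := g.2.2
      simp only [mul_smul] at this ⊢
      rw [this, inv_smul_smul]
    · exact hconj h g.1 g.2.1
    · have := g.2.2
      simp only [mul_smul] at this ⊢
      rw [inv_smul_smul, this]
    · simp [mul_assoc]
    · simp [mul_assoc]
  rw [← Nat.card_congr (Equiv.ofBijective _ hbij), Nat.card_sigma,
    Finset.sum_congr rfl fun x _ => hfib x, Finset.sum_const, Finset.card_univ, smul_eq_mul,
    Nat.card_eq_fintype_card (α := orbit G o)]

/-- If two elements with `g ^ p = 1` have a single fixed point each, then these points lie in one
orbit. -/
theorem mem_orbit_of_fixedBy_eq_singleton [Finite G] {p : ℕ} [Fact p.Prime] {g h : G} {x y : X}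
    (hg : g ^ p = 1) (hh : h ^ p = 1) (hgx : fixedBy X g = {x}) (hhy : fixedBy X h = {y}) :
    y ∈ orbit G x := by
  have hP : ∀ g : G, g ^ p = 1 → IsPGroup p (Subgroup.zpowers g) := by
    rintro g hg ⟨-, n, rfl⟩
    refine ⟨1, Subtype.ext ?_⟩
    change (g ^ n) ^ p ^ 1 = 1
    rw [pow_one, ← zpow_natCast, ← zpow_mul, mul_comm, zpow_mul, zpow_natCast, hg, one_zpow]
  have hfp : ∀ (g : G) (a : orbit G x), a ∈ fixedPoints (Subgroup.zpowers g) (orbit G x) ↔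
      (a : X) ∈ fixedBy X g := by
    intro g a
    constructor
    · intro h
      exact congrArg Subtype.val (h ⟨g, Subgroup.mem_zpowers g⟩)
    · rintro h ⟨-, n, rfl⟩
      have : g ^ n ∈ stabilizer G (a : X) := zpow_mem (show g ∈ stabilizer G (a : X) from h) n
      exact Subtype.ext this
  -- Otherwise the p-group of g has one fixed point on the orbit of x and that of h has none, so the
  -- orbit length is both 1 and 0 modulo p.
  by_contra hy
  have : Finite (orbit G x) := Set.finite_range _
  have h1 := (hP g hg).card_modEq_card_fixedPoints (orbit G x)
  have h2 := (hP h hh).card_modEq_card_fixedPoints (orbit G x)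
  have e1 : fixedPoints (Subgroup.zpowers g) (orbit G x) = {⟨x, mem_orbit_self x⟩} := by
    ext a
    rw [hfp, hgx, Set.mem_singleton_iff, Set.mem_singleton_iff, Subtype.ext_iff]
  have e2 : fixedPoints (Subgroup.zpowers h) (orbit G x) = ∅ := by
    ext a
    rw [hfp, hhy, Set.mem_singleton_iff]
    simp only [Set.mem_empty_iff_false, iff_false]
    rintro rfl
    exact hy a.2
  rw [e1] at h1
  rw [e2] at h2
  have h3 := h1.symm.trans h2
  rw [Nat.card_unique, Nat.card_of_isEmpty] at h3
  exact (Nat.Prime.one_lt Fact.out).ne' (Nat.dvd_one.1 ((Nat.modEq_zero_iff_dvd).1 h3))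

end OrbitCounting

/-- Cancel q. Then 1+mq divides 2dm and is prime to m, so 2d = (1+mq)e and e(1+m(q-2)) = 2k ≤
2(q-1). For m = 2 this forces e = 1 and fails by parity; for m ≥ 3 it forces q = 3 and then m = 3.
-/
theorem eq_one_or_of_mul_eq {q m k d : ℕ} (hq : Odd q) (hq3 : 3 ≤ q) (hm : 1 ≤ m) (hd : 2 ≤ d)
    (hk : k ≤ q - 1) (h : d * ((1 + m * q) * (q - 2) + 2) = (1 + m * q) * q * k) :
    m = 1 ∨ (q = 3 ∧ m = 3 ∧ k = 2 ∧ d = 5) := by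
  obtain ⟨r, rfl⟩ : ∃ r, q = r + 2 := ⟨q - 2, by omega⟩
  have hr : Odd r := by
    rcases hq with ⟨t, ht⟩
    exact ⟨t - 1, by omega⟩
  have hr1 : 1 ≤ r := by omega
  rw [Nat.add_sub_cancel] at h
  have h1 : d * (1 + m * r) = (1 + m * (r + 2)) * k := by
    have : (r + 2) * (d * (1 + m * r)) = (r + 2) * ((1 + m * (r + 2)) * k) := by linarith
    exact Nat.eq_of_mul_eq_mul_left (by omega) this
  have h2 : 1 + m * (r + 2) ∣ m * (2 * d) := by
    refine (Nat.dvd_add_right (Dvd.intro k h1.symm : 1 + m * (r + 2) ∣ d * (1 + m * r))).1 ?_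
    exact ⟨d, by ring⟩
  have h3 : Nat.Coprime (1 + m * (r + 2)) m := by simp
  obtain ⟨e, he⟩ := h3.dvd_of_dvd_mul_left h2
  have he1 : 1 ≤ e := by
    rcases Nat.eq_zero_or_pos e with h0 | h0
    · rw [h0] at he; omega
    · exact h0
  have h4 : e * (1 + m * r) = 2 * k := by
    have : (1 + m * (r + 2)) * (e * (1 + m * r)) = (1 + m * (r + 2)) * (2 * k) := by
      calc _ = ((1 + m * (r + 2)) * e) * (1 + m * r) := by ring
        _ = 2 * (d * (1 + m * r)) := by rw [← he]; ring
        _ = _ := by rw [h1]; ring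
    exact Nat.eq_of_mul_eq_mul_left (by omega) this
  have hk' : 2 * k ≤ 2 * (r + 1) := by omega
  rw [← h4] at hk'
  rcases (show m = 1 ∨ m = 2 ∨ 3 ≤ m by omega) with h5 | rfl | h5
  · exact Or.inl h5
  · exfalso
    have : e = 1 := by
      by_contra hne
      have : 2 ≤ e := by omega
      nlinarith
    subst this
    omega
  · right
    have hb : 1 * (1 + m * r) ≤ e * (1 + m * r) := Nat.mul_le_mul_right _ he1
    have hr' : r = 1 := by nlinarith
    subst hr'
    have hm' : m = 3 := by omega
    subst hm'
    have : e = 1 := by omega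
    subst this
    omega

/-! ### SL(2,L) on the projective line -/

section Moebius

open MulAction Matrix OnePoint

variable {L : Type*} [Field L]

/-- The upper unitriangular element of `SL(2, L)` with upper right entry `a`. -/
def upper (a : L) : SpecialLinearGroup (Fin 2) L := ⟨!![1, a; 0, 1], by simp⟩

/-- The lower unitriangular element of `SL(2, L)` with lower left entry `b`. -/
def lower (b : L) : SpecialLinearGroup (Fin 2) L := ⟨!![1, 0; b, 1], by simp⟩

theorem sl2_ext {g h : SpecialLinearGroup (Fin 2) L} (h00 : g 0 0 = h 0 0) (h01 : g 0 1 = h 0 1)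
    (h10 : g 1 0 = h 1 0) (h11 : g 1 1 = h 1 1) : g = h := by
  ext i j
  fin_cases i <;> fin_cases j <;> assumption

@[simp] theorem upper_00 (a : L) : upper a 0 0 = 1 := rfl
@[simp] theorem upper_01 (a : L) : upper a 0 1 = a := rfl
@[simp] theorem upper_10 (a : L) : upper a 1 0 = 0 := rfl
@[simp] theorem upper_11 (a : L) : upper a 1 1 = 1 := rfl
@[simp] theorem lower_00 (a : L) : lower a 0 0 = 1 := rfl
@[simp] theorem lower_01 (a : L) : lower a 0 1 = 0 := rfl
@[simp] theorem lower_10 (a : L) : lower a 1 0 = a := rfl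
@[simp] theorem lower_11 (a : L) : lower a 1 1 = 1 := rfl

theorem sl2_mul_apply (g h : SpecialLinearGroup (Fin 2) L) (i j : Fin 2) :
    (g * h) i j = g i 0 * h 0 j + g i 1 * h 1 j := by
  change (g.1 * h.1) i j = _
  rw [Matrix.mul_apply, Fin.sum_univ_two]

theorem sl2_det (g : SpecialLinearGroup (Fin 2) L) : g 0 0 * g 1 1 - g 0 1 * g 1 0 = 1 := by
  have := g.2
  rwa [Matrix.det_fin_two] at this

@[simp] theorem sl2_inv_00 (g : SpecialLinearGroup (Fin 2) L) : g⁻¹ 0 0 = g 1 1 := by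
  simp [SpecialLinearGroup.SL2_inv_expl]
@[simp] theorem sl2_inv_01 (g : SpecialLinearGroup (Fin 2) L) : g⁻¹ 0 1 = -g 0 1 := by
  simp [SpecialLinearGroup.SL2_inv_expl]
@[simp] theorem sl2_inv_10 (g : SpecialLinearGroup (Fin 2) L) : g⁻¹ 1 0 = -g 1 0 := by
  simp [SpecialLinearGroup.SL2_inv_expl]
@[simp] theorem sl2_inv_11 (g : SpecialLinearGroup (Fin 2) L) : g⁻¹ 1 1 = g 0 0 := by
  simp [SpecialLinearGroup.SL2_inv_expl]

@[simp] theorem sl2_neg_apply (g : SpecialLinearGroup (Fin 2) L) (i j : Fin 2) :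
    (-g) i j = -g i j := rfl

@[simp] theorem sl2_one_00 : (1 : SpecialLinearGroup (Fin 2) L) 0 0 = 1 := rfl
@[simp] theorem sl2_one_01 : (1 : SpecialLinearGroup (Fin 2) L) 0 1 = 0 := rfl
@[simp] theorem sl2_one_10 : (1 : SpecialLinearGroup (Fin 2) L) 1 0 = 0 := rfl
@[simp] theorem sl2_one_11 : (1 : SpecialLinearGroup (Fin 2) L) 1 1 = 1 := rfl

@[simp] theorem upper_zero : upper (0 : L) = 1 := by apply sl2_ext <;> simp
@[simp] theorem lower_zero : lower (0 : L) = 1 := by apply sl2_ext <;> simp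

theorem upper_mul (a b : L) : upper a * upper b = upper (a + b) := by
  apply sl2_ext <;> simp [sl2_mul_apply, add_comm]

theorem upper_inv (a : L) : (upper a)⁻¹ = upper (-a) := by
  apply sl2_ext <;> simp

theorem lower_mul (a b : L) : lower a * lower b = lower (a + b) := by
  apply sl2_ext <;> simp [sl2_mul_apply, add_comm]

theorem lower_inv (a : L) : (lower a)⁻¹ = lower (-a) := by
  apply sl2_ext <;> simp

theorem upper_pow (a : L) (n : ℕ) : upper a ^ n = upper (n * a) := by
  induction n with
  | zero => simp
  | succ n ih => rw [pow_succ, ih, upper_mul]; push_cast; ring_nf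

theorem lower_pow (a : L) (n : ℕ) : lower a ^ n = lower (n * a) := by
  induction n with
  | zero => simp
  | succ n ih => rw [pow_succ, ih, lower_mul]; push_cast; ring_nf

theorem upper_injective : Function.Injective (upper : L → _) := fun a b h => by
  simpa using congrArg (fun g : SpecialLinearGroup (Fin 2) L => g 0 1) h

theorem eq_upper {g : SpecialLinearGroup (Fin 2) L} (h10 : g 1 0 = 0) (h00 : g 0 0 = 1) :
    g = upper (g 0 1) := by
  have := sl2_det g
  apply sl2_ext <;> simp_all

variable [DecidableEq L]

/-- The action of `SL(2, L)` on the projective line by Moebius transformations. -/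
noncomputable instance moebius : MulAction (SpecialLinearGroup (Fin 2) L) (OnePoint L) :=
  MulAction.compHom _ SpecialLinearGroup.toGL

theorem sl2_smul_infty (g : SpecialLinearGroup (Fin 2) L) :
    g • (∞ : OnePoint L) = if g 1 0 = 0 then ∞ else ((g 0 0 / g 1 0 : L) : OnePoint L) :=
  smul_infty_eq_ite (SpecialLinearGroup.toGL g)

theorem sl2_smul_coe (g : SpecialLinearGroup (Fin 2) L) (x : L) :
    g • (x : OnePoint L) = if g 1 0 * x + g 1 1 = 0 then ∞ else
      (((g 0 0 * x + g 0 1) / (g 1 0 * x + g 1 1) : L) : OnePoint L) :=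
  smul_some_eq_ite (g := SpecialLinearGroup.toGL g)

theorem sl2_smul_infty_eq_iff (g : SpecialLinearGroup (Fin 2) L) :
    g • (∞ : OnePoint L) = ∞ ↔ g 1 0 = 0 := by
  rw [sl2_smul_infty]
  split_ifs with h <;> simp [h]

theorem upper_smul_coe (a x : L) : upper a • (x : OnePoint L) = ((x + a : L) : OnePoint L) := by
  simp [sl2_smul_coe]

theorem upper_smul_infty (a : L) : upper a • (∞ : OnePoint L) = ∞ := by
  simp [sl2_smul_infty]

theorem neg_one_smul (x : OnePoint L) : (-1 : SpecialLinearGroup (Fin 2) L) • x = x := by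
  cases x with
  | infty => simp [sl2_smul_infty]
  | coe x => simp [sl2_smul_coe]

theorem exists_smul_infty_eq (x : OnePoint L) :
    ∃ h : SpecialLinearGroup (Fin 2) L, h • (∞ : OnePoint L) = x := by
  cases x with
  | infty => exact ⟨1, one_smul _ _⟩
  | coe x =>
    let h : SpecialLinearGroup (Fin 2) L := ⟨!![x, -1; 1, 0], by simp⟩
    have h00 : h 0 0 = x := rfl
    have h10 : h 1 0 = 1 := rfl
    exact ⟨h, by rw [sl2_smul_infty, h00, h10, if_neg one_ne_zero, div_one]⟩

omit [DecidableEq L] in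
theorem neg_one_ne_one (h2 : (2 : L) ≠ 0) : (-1 : SpecialLinearGroup (Fin 2) L) ≠ 1 := by
  intro h
  have h3 : (-1 : L) = 1 := congrArg (fun g : SpecialLinearGroup (Fin 2) L => g 0 0) h
  exact h2 (by linear_combination -h3)

/-- The finite fixed points are the roots of cx²+(d-a)x-b. A root cannot be the pole of g, since the
determinant is 1. -/
theorem exists_smul_eq_self [IsAlgClosed L] (h2 : (2 : L) ≠ 0)
    (g : SpecialLinearGroup (Fin 2) L) : ∃ x : OnePoint L, g • x = x := by
  by_cases hc : g 1 0 = 0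
  · exact ⟨∞, (sl2_smul_infty_eq_iff g).2 hc⟩
  have : NeZero (2 : L) := ⟨h2⟩
  obtain ⟨s, hs⟩ := IsAlgClosed.exists_pow_nat_eq
    (discrim (g 1 0) (g 1 1 - g 0 0) (-g 0 1)) (n := 2) (by norm_num)
  obtain ⟨x, hx⟩ := exists_quadratic_eq_zero hc ⟨s, by rw [← hs, pow_two]⟩
  have hdet := sl2_det g
  have hne : g 1 0 * x + g 1 1 ≠ 0 := by
    intro h
    have h1 : g 0 0 * x + g 0 1 = 0 := by linear_combination x * h - hx
    have : (1 : L) = 0 := by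
      rw [← hdet]
      linear_combination g 0 0 * h - g 1 0 * h1
    exact one_ne_zero this
  refine ⟨x, ?_⟩
  rw [sl2_smul_coe, if_neg hne]
  congr 1
  rw [div_eq_iff hne]
  linear_combination -hx

/-- Up to conjugation every element of `SL(2, L)` is upper triangular. -/
theorem exists_conj_apply_eq_zero {g : SpecialLinearGroup (Fin 2) L} {x : OnePoint L}
    (hx : g • x = x) :
    ∃ h : SpecialLinearGroup (Fin 2) L, h • (∞ : OnePoint L) = x ∧ (h⁻¹ * g * h) 1 0 = 0 := by
  obtain ⟨h, hh⟩ := exists_smul_infty_eq x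
  refine ⟨h, hh, (sl2_smul_infty_eq_iff _).1 ?_⟩
  rw [mul_smul, mul_smul, hh, hx, ← hh, inv_smul_smul]

/-- Besides ∞, the fixed points solve (a-d)x = -b. As ad = 1, there is one solution if a² ≠ 1;
otherwise a = d = ±1, and b ≠ 0 excludes any. -/
theorem ncard_fixedBy_of_apply_eq_zero {g : SpecialLinearGroup (Fin 2) L} (h10 : g 1 0 = 0)
    (h1 : g ≠ 1) (h2 : g ≠ -1) :
    ((fixedBy (OnePoint L) g).ncard = 2 ∧ g 0 0 ^ 2 ≠ 1) ∨
      (fixedBy (OnePoint L) g = {∞} ∧ ∃ b ≠ 0, g = upper b ∨ g = -upper b) := by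
  have hdet := sl2_det g
  rw [h10, mul_zero, sub_zero] at hdet
  have ha : g 0 0 ≠ 0 := left_ne_zero_of_mul_eq_one hdet
  have hd : g 1 1 ≠ 0 := right_ne_zero_of_mul_eq_one hdet
  have hinf : g • (∞ : OnePoint L) = ∞ := (sl2_smul_infty_eq_iff g).2 h10
  have hcoe : ∀ x : L, g • (x : OnePoint L) = x ↔ (g 0 0 - g 1 1) * x = -g 0 1 := by
    intro x
    rw [sl2_smul_coe, h10, zero_mul, zero_add, if_neg hd, OnePoint.coe_eq_coe, div_eq_iff hd]
    constructor <;> intro h <;> linear_combination h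
  by_cases hsq : g 0 0 ^ 2 = 1
  · right
    have hb : g 0 1 ≠ 0 := by
      intro hb
      rcases sq_eq_one_iff.1 hsq with h | h
      · refine h1 (sl2_ext h hb h10 ?_)
        rw [h, one_mul] at hdet; exact hdet
      · refine h2 (sl2_ext h (by simpa using hb) (by simpa using h10) ?_)
        simp only [sl2_neg_apply, sl2_one_11]
        rw [h] at hdet; linear_combination -hdet
    have had : g 0 0 = g 1 1 := by
      have : g 0 0 * (g 0 0 - g 1 1) = 0 := by linear_combination hsq - hdet
      exact sub_eq_zero.1 ((mul_eq_zero.1 this).resolve_left ha)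
    refine ⟨?_, ?_⟩
    · ext x
      cases x with
      | infty => simpa using hinf
      | coe x =>
        rw [mem_fixedBy, hcoe, had, sub_self, zero_mul, Set.mem_singleton_iff]
        simpa using hb
    · rcases sq_eq_one_iff.1 hsq with h | h
      · exact ⟨_, hb, Or.inl (eq_upper h10 h)⟩
      · refine ⟨-g 0 1, neg_ne_zero.2 hb, Or.inr ?_⟩
        apply sl2_ext <;> simp [h10, ← had, h]
  · left
    have hne : g 0 0 - g 1 1 ≠ 0 := by
      intro h
      exact hsq (by linear_combination hdet + g 0 0 * h)
    refine ⟨Set.ncard_eq_two.2 ⟨∞, ((-g 0 1 / (g 0 0 - g 1 1) : L) : OnePoint L), by simp, ?_⟩, hsq⟩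
    ext x
    cases x with
    | infty => simpa using hinf
    | coe x =>
      rw [mem_fixedBy, hcoe]
      simp [eq_div_iff hne, mul_comm]

theorem fixedBy_upper {a : L} (ha : a ≠ 0) : fixedBy (OnePoint L) (upper a) = {∞} := by
  ext x
  cases x with
  | infty => simp [upper_smul_infty]
  | coe x => simp [upper_smul_coe, ha]

theorem fixedBy_neg (g : SpecialLinearGroup (Fin 2) L) :
    fixedBy (OnePoint L) (-g) = fixedBy (OnePoint L) g := by
  ext x
  rw [mem_fixedBy, mem_fixedBy, ← neg_one_mul, mul_smul, neg_one_smul]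

omit [DecidableEq L] in
theorem conj_ne_one {g : SpecialLinearGroup (Fin 2) L} (h1 : g ≠ 1)
    (h : SpecialLinearGroup (Fin 2) L) : h⁻¹ * g * h ≠ 1 := by
  intro h4
  rw [mul_assoc, inv_mul_eq_iff_eq_mul, mul_one] at h4
  exact h1 (by simpa using h4)

omit [DecidableEq L] in
theorem conj_ne_neg_one {g : SpecialLinearGroup (Fin 2) L} (hn : g ≠ -1)
    (h : SpecialLinearGroup (Fin 2) L) : h⁻¹ * g * h ≠ -1 := by
  intro h4
  rw [mul_assoc, inv_mul_eq_iff_eq_mul] at h4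
  simp only [mul_neg, mul_one] at h4
  rw [← neg_one_mul] at h4
  exact hn (mul_right_cancel h4)

theorem ncard_fixedBy_eq_one_or_two [IsAlgClosed L] (h2 : (2 : L) ≠ 0)
    {g : SpecialLinearGroup (Fin 2) L} (h1 : g ≠ 1) (hn : g ≠ -1) :
    (fixedBy (OnePoint L) g).ncard = 1 ∨ (fixedBy (OnePoint L) g).ncard = 2 := by
  obtain ⟨x, hx⟩ := exists_smul_eq_self h2 g
  obtain ⟨h, -, hh⟩ := exists_conj_apply_eq_zero hx
  have e : (fixedBy (OnePoint L) (h⁻¹ * g * h)).ncard = (fixedBy (OnePoint L) g).ncard := by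
    simpa using ncard_fixedBy_conj (X := OnePoint L) h⁻¹ g
  rw [← e]
  rcases ncard_fixedBy_of_apply_eq_zero hh (conj_ne_one h1 h) (conj_ne_neg_one hn h) with h3 | h3
  · exact Or.inr h3.1
  · left; rw [h3.1, Set.ncard_singleton]

/-- If `g` fixes a single point `x`, then so does `g ^ 2`, which has order `p`. -/
theorem sq_of_fixedBy_eq_singleton {p : ℕ} [CharP L p] (h2 : (2 : L) ≠ 0)
    {g : SpecialLinearGroup (Fin 2) L} (h1 : g ≠ 1) (hn : g ≠ -1) {x : OnePoint L}
    (hx : fixedBy (OnePoint L) g = {x}) :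
    (g ^ 2) ^ p = 1 ∧ fixedBy (OnePoint L) (g ^ 2) = {x} := by
  have hgx : g • x = x := by
    have : x ∈ fixedBy (OnePoint L) g := by rw [hx]; rfl
    exact this
  obtain ⟨h, hhx, hh⟩ := exists_conj_apply_eq_zero hgx
  have e : (fixedBy (OnePoint L) (h⁻¹ * g * h)).ncard = (fixedBy (OnePoint L) g).ncard := by
    simpa using ncard_fixedBy_conj (X := OnePoint L) h⁻¹ g
  rcases ncard_fixedBy_of_apply_eq_zero hh (conj_ne_one h1 h) (conj_ne_neg_one hn h) with h3 | h3
  · rw [e, hx, Set.ncard_singleton] at h3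
    omega
  · obtain ⟨-, b, hb, hgb⟩ := h3
    have hsq : g ^ 2 = h * upper (2 * b) * h⁻¹ := by
      have h5 : (h⁻¹ * g * h) ^ 2 = upper (2 * b) := by
        rcases hgb with h4 | h4
        · rw [h4, upper_pow]; simp
        · rw [h4, neg_sq, upper_pow]; simp
      rw [← h5, pow_two, pow_two]
      group
    refine ⟨?_, ?_⟩
    · rw [hsq, conj_pow, upper_pow]
      simp
    · rw [hsq, ← smul_fixedBy, fixedBy_upper (mul_ne_zero h2 hb)]
      simp [hhx]

theorem fixedBy_lower {a : L} (ha : a ≠ 0) :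
    fixedBy (OnePoint L) (lower a) = {((0 : L) : OnePoint L)} := by
  ext x
  cases x with
  | infty => simp [sl2_smul_infty, ha]
  | coe x =>
    rw [mem_fixedBy, sl2_smul_coe, lower_00, lower_01, lower_10, lower_11, Set.mem_singleton_iff]
    by_cases h : a * x + 1 = 0
    · rw [if_pos h]
      have : x ≠ 0 := by rintro rfl; simp at h
      simpa using this
    · rw [if_neg h, OnePoint.coe_eq_coe, OnePoint.coe_eq_coe, div_eq_iff h]
      constructor
      · intro h'
        have : a * (x * x) = 0 := by linear_combination -h'
        simpa [ha] using this
      · rintro rfl; simp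

end Moebius

/-! ### Stabilizer and orbit of ∞ in a finite group -/

section FiniteSubgroups

open MulAction Matrix OnePoint

variable {L : Type*} [Field L]

/-- The additive group of all `a` such that `upper a` lies in `G`. -/
def upperSubgroup (G : Subgroup (SpecialLinearGroup (Fin 2) L)) : AddSubgroup L where
  carrier := {a | upper a ∈ G}
  zero_mem' := by simp [one_mem]
  add_mem' := fun {a b} ha hb => by
    change upper (a + b) ∈ G
    rw [← upper_mul]; exact mul_mem ha hb
  neg_mem' := fun {a} ha => by
    change upper (-a) ∈ G
    rw [← upper_inv]; exact inv_mem ha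

theorem mem_upperSubgroup {G : Subgroup (SpecialLinearGroup (Fin 2) L)} {a : L} :
    a ∈ upperSubgroup G ↔ upper a ∈ G := Iff.rfl

instance finite_upperSubgroup (G : Subgroup (SpecialLinearGroup (Fin 2) L)) [Finite G] :
    Finite (upperSubgroup G) :=
  Finite.of_injective (fun a : upperSubgroup G => (⟨upper a.1, a.2⟩ : G)) fun _ _ h =>
    Subtype.ext (upper_injective (congrArg Subtype.val h))

theorem odd_card_upperSubgroup (h2 : (2 : L) ≠ 0) (G : Subgroup (SpecialLinearGroup (Fin 2) L))
    [Finite G] : Odd (Nat.card (upperSubgroup G)) := by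
  rw [← Nat.not_even_iff_odd, even_iff_two_dvd]
  intro h
  have : Fact (Nat.Prime 2) := ⟨Nat.prime_two⟩
  obtain ⟨x, hx⟩ := exists_prime_addOrderOf_dvd_card' 2 h
  have h1 : 2 • x = 0 := hx ▸ addOrderOf_nsmul_eq_zero x
  have h3 : (2 : L) * x = 0 := by
    have := congrArg (Subtype.val : upperSubgroup G → L) h1
    simpa using this
  have h4 : x = 0 := Subtype.ext ((mul_eq_zero.1 h3).resolve_left h2)
  rw [h4, addOrderOf_zero] at hx
  omega

theorem three_le_card_upperSubgroup (h2 : (2 : L) ≠ 0)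
    {G : Subgroup (SpecialLinearGroup (Fin 2) L)} [Finite G] (h1 : upper 1 ∈ G) :
    3 ≤ Nat.card (upperSubgroup G) := by
  have ho := odd_card_upperSubgroup h2 G
  have : Nontrivial (upperSubgroup G) :=
    ⟨⟨⟨1, h1⟩, 0, fun h => one_ne_zero (congrArg Subtype.val h)⟩⟩
  have := Finite.one_lt_card (α := upperSubgroup G)
  rcases ho with ⟨t, ht⟩
  omega

variable [DecidableEq L]

/-- The upper left entry as a homomorphism on the stabilizer of `∞`. -/
def diagHom (G : Subgroup (SpecialLinearGroup (Fin 2) L)) :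
    stabilizer G (∞ : OnePoint L) →* L where
  toFun g := g.1.1 0 0
  map_one' := rfl
  map_mul' := fun g h => by
    have hh : h.1.1 1 0 = 0 := (sl2_smul_infty_eq_iff h.1.1).1 h.2
    change (g.1.1 * h.1.1) 0 0 = _
    rw [sl2_mul_apply, hh, mul_zero, add_zero]

theorem card_ker_diagHom (G : Subgroup (SpecialLinearGroup (Fin 2) L)) :
    Nat.card (diagHom G).toHomUnits.ker = Nat.card (upperSubgroup G) := by
  have hmem : ∀ g : stabilizer G (∞ : OnePoint L), g ∈ (diagHom G).toHomUnits.ker ↔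
      g.1.1 0 0 = 1 := by
    intro g
    rw [MonoidHom.mem_ker, Units.ext_iff]
    rfl
  have hup : ∀ g : (diagHom G).toHomUnits.ker, g.1.1.1 = upper (g.1.1.1 0 1) := fun g =>
    eq_upper ((sl2_smul_infty_eq_iff g.1.1.1).1 g.1.2) ((hmem g.1).1 g.2)
  refine Nat.card_congr ⟨fun g => ⟨g.1.1.1 0 1, ?_⟩, fun a => ⟨⟨⟨upper a.1, a.2⟩, ?_⟩, ?_⟩, ?_, ?_⟩
  · rw [mem_upperSubgroup, ← hup]
    exact g.1.1.2
  · exact upper_smul_infty a.1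
  · rw [hmem]; rfl
  · intro g
    exact Subtype.ext (Subtype.ext (Subtype.ext (hup g).symm))
  · intro a
    rfl

/-- The upper left entry maps the stabilizer onto a group of units of even order 2k, as it contains
-1, with kernel of order q. Conjugating `upper 1` by an element with entry a gives `upper (a ^ 2)`;
squaring is at most two-to-one into the q-1 nonzero translations, so 2k ≤ 2(q-1). -/
theorem exists_card_stabilizer_infty (h2 : (2 : L) ≠ 0)
    {G : Subgroup (SpecialLinearGroup (Fin 2) L)} [Finite G] (hneg : -1 ∈ G) (h1 : upper 1 ∈ G) :
    ∃ k, k ≤ Nat.card (upperSubgroup G) - 1 ∧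
      Nat.card (stabilizer G (∞ : OnePoint L)) = 2 * Nat.card (upperSubgroup G) * k := by
  classical
  set f := (diagHom G).toHomUnits with hf
  have hcard := f.ker.card_mul_index
  rw [Subgroup.index_ker, card_ker_diagHom] at hcard
  have hval : ∀ g, ((f g : Lˣ) : L) = g.1.1 0 0 := fun _ => rfl
  have hn1 : (-1 : Lˣ) ∈ f.range := by
    refine ⟨⟨⟨-1, hneg⟩, neg_one_smul _⟩, Units.ext ?_⟩
    rw [hval]; simp
  have heven : 2 ∣ Nat.card f.range := by
    have h : orderOf (⟨-1, hn1⟩ : f.range) = 2 := by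
      refine orderOf_eq_prime (by ext; simp) fun h => h2 ?_
      have h3 : (-1 : L) = 1 := congrArg (fun u : f.range => ((u.1 : Lˣ) : L)) h
      linear_combination -h3
    exact h.symm.dvd.trans (orderOf_dvd_natCard (⟨-1, hn1⟩ : f.range))
  obtain ⟨k, hk⟩ := heven
  refine ⟨k, ?_, by rw [← hcard, hk]; ring⟩
  have hsq : ∀ u ∈ f.range, (u : L) ^ 2 ∈ upperSubgroup G := by
    rintro - ⟨g, rfl⟩
    have hg10 : g.1.1 1 0 = 0 := (sl2_smul_infty_eq_iff g.1.1).1 g.2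
    rw [mem_upperSubgroup, hval]
    have : upper (g.1.1 0 0 ^ 2) = g.1.1 * upper 1 * g.1.1⁻¹ := by
      have := sl2_det g.1.1
      rw [hg10] at this
      apply sl2_ext <;> simp [sl2_mul_apply, hg10]
      · linear_combination -this
      · ring
      · linear_combination -this
    rw [this]
    exact mul_mem (mul_mem g.1.2 h1) (inv_mem g.1.2)
  have : Finite f.range := Set.finite_range f
  have := Fintype.ofFinite f.range
  have := Fintype.ofFinite (upperSubgroup G)
  let F : f.range → upperSubgroup G := fun u => ⟨(u.1 : L) ^ 2, hsq u.1 u.2⟩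
  have hle := Finset.card_le_mul_card_image_of_maps_to (f := F) (s := Finset.univ)
    (t := Finset.univ.erase 0) (fun u _ => by
      refine Finset.mem_erase.2 ⟨fun h => ?_, Finset.mem_univ _⟩
      exact pow_ne_zero 2 (Units.ne_zero u.1) (congrArg Subtype.val h)) 2 (fun b _ => by
      by_cases hb : ∃ u₀, F u₀ = b
      · obtain ⟨u₀, rfl⟩ := hb
        refine (Finset.card_le_card (t := {u₀, ⟨-1, hn1⟩ * u₀}) fun u hu => ?_).trans
          Finset.card_le_two
        have h3 : (u.1 : L) ^ 2 = (u₀.1 : L) ^ 2 :=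
          congrArg Subtype.val (Finset.mem_filter.1 hu).2
        rw [Finset.mem_insert, Finset.mem_singleton]
        rcases sq_eq_sq_iff_eq_or_eq_neg.1 h3 with h | h
        · left; exact Subtype.ext (Units.ext h)
        · right; exact Subtype.ext (Units.ext (by simpa using h))
      · rw [Finset.filter_eq_empty_iff.2 fun u _ h => hb ⟨u, h⟩]
        simp)
  rw [Finset.card_erase_of_mem (Finset.mem_univ _), Finset.card_univ, Finset.card_univ,
    ← Nat.card_eq_fintype_card, ← Nat.card_eq_fintype_card, hk] at hle
  omega

/-- These elements are ±`upper a` with a ≠ 0, and the two signs never give the same matrix. -/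
theorem card_fixedBy_eq_one_and_infty (h2 : (2 : L) ≠ 0)
    {G : Subgroup (SpecialLinearGroup (Fin 2) L)} [Finite G] (hneg : -1 ∈ G) :
    Nat.card {g : G // (g ≠ 1 ∧ g ≠ ⟨-1, hneg⟩ ∧ (fixedBy (OnePoint L) g).ncard = 1) ∧
      g • (∞ : OnePoint L) = ∞} = 2 * (Nat.card (upperSubgroup G) - 1) := by
  classical
  have hc : Nat.card {a : upperSubgroup G // a ≠ 0} = Nat.card (upperSubgroup G) - 1 := by
    have := Fintype.ofFinite (upperSubgroup G)
    rw [Nat.card_eq_fintype_card, Nat.card_eq_fintype_card, Fintype.card_subtype_compl,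
      Fintype.card_subtype_eq]
  have hneg_mem : ∀ g ∈ G, -g ∈ G := fun g hg => by
    rw [← neg_one_mul]; exact mul_mem hneg hg
  have hpar : ∀ g : G, (g : SpecialLinearGroup (Fin 2) L) 0 1 ≠ 0 → g ≠ 1 ∧ g ≠ ⟨-1, hneg⟩ := by
    intro g hg
    constructor <;> rintro rfl <;> simp at hg
  let Φ : Bool × {a : upperSubgroup G // a ≠ 0} → {g : G // (g ≠ 1 ∧ g ≠ ⟨-1, hneg⟩ ∧
      (fixedBy (OnePoint L) g).ncard = 1) ∧ g • (∞ : OnePoint L) = ∞} := fun x =>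
    if x.1 then ⟨⟨upper x.2.1.1, x.2.1.2⟩, by
        have ha : x.2.1.1 ≠ 0 := fun h => x.2.2 (Subtype.ext h)
        have h := hpar ⟨upper x.2.1.1, x.2.1.2⟩ (by simpa using ha)
        refine ⟨⟨h.1, h.2, ?_⟩, upper_smul_infty _⟩
        change (fixedBy (OnePoint L) (upper x.2.1.1)).ncard = 1
        rw [fixedBy_upper ha, Set.ncard_singleton]⟩
      else ⟨⟨-upper x.2.1.1, hneg_mem _ x.2.1.2⟩, by
        have ha : x.2.1.1 ≠ 0 := fun h => x.2.2 (Subtype.ext h)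
        have h := hpar ⟨-upper x.2.1.1, hneg_mem _ x.2.1.2⟩ (by simpa using ha)
        have hf : fixedBy (OnePoint L) (-upper x.2.1.1) = {∞} := by
          rw [fixedBy_neg, fixedBy_upper ha]
        refine ⟨⟨h.1, h.2, ?_⟩, ?_⟩
        · change (fixedBy (OnePoint L) (-upper x.2.1.1)).ncard = 1
          rw [hf, Set.ncard_singleton]
        · change ∞ ∈ fixedBy (OnePoint L) (-upper x.2.1.1)
          rw [hf]; rfl⟩
  have ht : ∀ a, ((Φ (true, a)).1 : SpecialLinearGroup (Fin 2) L) = upper a.1.1 := fun a => rfl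
  have hf : ∀ a, ((Φ (false, a)).1 : SpecialLinearGroup (Fin 2) L) = -upper a.1.1 := fun a => rfl
  have hne : ∀ a b : L, upper a ≠ -upper b := by
    intro a b h
    have h3 : (1 : L) = -1 := congrArg (fun g : SpecialLinearGroup (Fin 2) L => g 0 0) h
    exact h2 (by linear_combination h3)
  have hbij : Function.Bijective Φ := by
    constructor
    · rintro ⟨ε, a⟩ ⟨η, b⟩ h
      have h' := congrArg (fun x => (x.1 : SpecialLinearGroup (Fin 2) L)) h
      cases ε <;> cases η <;> simp only [ht, hf] at h'
      · rw [neg_inj] at h'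
        rw [Subtype.ext (Subtype.ext (upper_injective h'))]
      · exact (hne _ _ h'.symm).elim
      · exact (hne _ _ h').elim
      · rw [Subtype.ext (Subtype.ext (upper_injective h'))]
    · rintro ⟨g, ⟨h1, h3, h4⟩, h5⟩
      have h10 : g.1 1 0 = 0 := (sl2_smul_infty_eq_iff g.1).1 h5
      have e1 : g.1 ≠ 1 := fun h => h1 (Subtype.ext h)
      have e2 : g.1 ≠ -1 := fun h => h3 (Subtype.ext h)
      rcases ncard_fixedBy_of_apply_eq_zero h10 e1 e2 with h | ⟨-, b, hb, h⟩
      · have h6 : (fixedBy (OnePoint L) g.1).ncard = 1 := h4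
        omega
      · rcases h with h | h
        · refine ⟨(true, ⟨⟨b, ?_⟩, fun h6 => hb (congrArg Subtype.val h6)⟩),
            Subtype.ext (Subtype.ext h.symm)⟩
          rw [mem_upperSubgroup, ← h]; exact g.2
        · refine ⟨(false, ⟨⟨b, ?_⟩, fun h6 => hb (congrArg Subtype.val h6)⟩),
            Subtype.ext (Subtype.ext h.symm)⟩
          rw [mem_upperSubgroup, ← neg_neg (upper b), ← h]
          exact hneg_mem _ g.2
  rw [← Nat.card_congr (Equiv.ofBijective Φ hbij), Nat.card_prod, hc]
  simp

/-- The finite points of the orbit of `∞`. -/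
def finiteOrbit (G : Subgroup (SpecialLinearGroup (Fin 2) L)) : Set L :=
  {a | (a : OnePoint L) ∈ orbit G (∞ : OnePoint L)}

theorem add_mem_finiteOrbit {G : Subgroup (SpecialLinearGroup (Fin 2) L)} {a s : L}
    (ha : a ∈ upperSubgroup G) (hs : s ∈ finiteOrbit G) : a + s ∈ finiteOrbit G := by
  have h := mem_orbit_of_mem_orbit (⟨upper a, ha⟩ : G) hs
  change upper a • (s : OnePoint L) ∈ _ at h
  rw [upper_smul_coe, add_comm] at h
  exact h

/-- Translations act freely on the finite points of the orbit; ∞ accounts for the extra 1. -/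
theorem card_orbit_infty (G : Subgroup (SpecialLinearGroup (Fin 2) L)) [Finite G] :
    (finiteOrbit G).Finite ∧ ∃ m, (finiteOrbit G).ncard = m * Nat.card (upperSubgroup G) ∧
      Nat.card (orbit G (∞ : OnePoint L)) = 1 + m * Nat.card (upperSubgroup G) := by
  have hfin : (orbit G (∞ : OnePoint L)).Finite := Set.finite_range _
  have hinj : Function.Injective (fun a : L => (a : OnePoint L)) := OnePoint.coe_injective
  have hS : (finiteOrbit G).Finite := hfin.preimage hinj.injOn
  refine ⟨hS, ?_⟩
  have horb : orbit G (∞ : OnePoint L) =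
      insert ∞ ((fun a : L => (a : OnePoint L)) '' finiteOrbit G) := by
    ext x
    cases x with
    | infty => simp [mem_orbit_self]
    | coe x => simp [finiteOrbit]
  let act : AddAction (upperSubgroup G) (finiteOrbit G) :=
    { vadd := fun a s => ⟨a.1 + s.1, add_mem_finiteOrbit a.2 s.2⟩
      zero_vadd := fun s => Subtype.ext (zero_add s.1)
      add_vadd := fun a b s => Subtype.ext (add_assoc a.1 b.1 s.1) }
  have hstab : ∀ s : finiteOrbit G, AddAction.stabilizer (upperSubgroup G) s = ⊥ := by
    intro s
    rw [eq_bot_iff]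
    intro a ha
    have h : a.1 + s.1 = s.1 := congrArg Subtype.val (AddAction.mem_stabilizer_iff.1 ha)
    rw [AddSubgroup.mem_bot]
    exact Subtype.ext (by simpa using h)
  have hc := Nat.card_congr (AddAction.selfEquivOrbitsQuotientProd hstab)
  rw [Nat.card_prod] at hc
  refine ⟨_, hc, ?_⟩
  rw [← hc]
  change (orbit G (∞ : OnePoint L)).ncard = 1 + (finiteOrbit G).ncard
  rw [horb, Set.ncard_insert_of_notMem (by simp) (hS.image _),
    Set.ncard_image_of_injective _ hinj, add_comm]

end FiniteSubgroups

/-! ### One regular orbit of translations, or the exceptional group -/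

section Dichotomy

open MulAction Matrix OnePoint

variable {L : Type*} [Field L] [DecidableEq L]

omit [DecidableEq L] in
theorem conj_apply_00_pow {g h : SpecialLinearGroup (Fin 2) L} {N : ℕ} (hg : g ^ N = 1)
    (hh : (h⁻¹ * g * h) 1 0 = 0) : (h⁻¹ * g * h) 0 0 ^ N = 1 := by
  set u := h⁻¹ * g * h with hu
  have hpow : ∀ n : ℕ, (u ^ n) 1 0 = 0 ∧ (u ^ n) 0 0 = u 0 0 ^ n := by
    intro n
    induction n with
    | zero => simp
    | succ n ih => simp [pow_succ, sl2_mul_apply, ih.1, ih.2, hh]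
  have h1 : u ^ N = 1 := by
    have : u = h⁻¹ * g * (h⁻¹)⁻¹ := by rw [inv_inv]
    rw [this, conj_pow, hg]; simp
  rw [← (hpow N).2, h1]; simp

omit [DecidableEq L] in
-- Here a and d play the role of eigenvalues. In characteristic 3, a^12 = 1 means a^4 = 1, so ninth
-- powers fix a and d; a^10 = 1 means that they swap them.
theorem add_pow_nine [CharP L 3] {a d : L} (had : a * d = 1) (ha : a ^ 12 = 1 ∨ a ^ 10 = 1) :
    (a + d) ^ 9 = a + d := by
  have : Fact (Nat.Prime 3) := ⟨Nat.prime_three⟩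
  have h9 : (a + d) ^ 9 = a ^ 9 + d ^ 9 := add_pow_char_pow a d 3 2
  rw [h9]
  have hd9 : a ^ 9 * d ^ 9 = 1 := by rw [← mul_pow, had, one_pow]
  have ha0 : a ≠ 0 := left_ne_zero_of_mul_eq_one had
  rcases ha with h | h
  · have h4 : a ^ 4 = 1 := by
      have : (a ^ 4 - 1) ^ 3 = 0 := by
        rw [sub_pow_char, ← pow_mul, h, one_pow, sub_self]
      exact sub_eq_zero.1 (pow_eq_zero_iff (by norm_num) |>.1 this)
    have ha9 : a ^ 9 = a := by
      calc a ^ 9 = (a ^ 4) ^ 2 * a := by ring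
        _ = a := by rw [h4]; ring
    rw [ha9] at hd9 ⊢
    rw [mul_left_cancel₀ ha0 (hd9.trans had.symm)]
  · have ha9 : a ^ 9 = d := by
      apply mul_left_cancel₀ ha0
      rw [had, ← h]; ring
    rw [ha9, mul_comm] at hd9
    rw [ha9]
    have hd0 : d ≠ 0 := right_ne_zero_of_mul_eq_one had
    rw [mul_right_cancel₀ hd0 (hd9.trans had.symm), add_comm]

/-- The points fixed by a transvection in `G` are those of `∞` under translations by `G`, or else
`G` is one of the exceptional groups over the field with nine elements. -/
theorem finiteOrbit_eq_or [IsAlgClosed L] {p : ℕ} [Fact p.Prime] [CharP L p] (hp : p ≠ 2)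
    {G : Subgroup (SpecialLinearGroup (Fin 2) L)} [Finite G] (hneg : -1 ∈ G) (h1 : upper 1 ∈ G)
    {w : L} (hw : w ≠ 0) (hwG : lower w ∈ G) :
    ((0 : L) ∈ finiteOrbit G ∧ finiteOrbit G = upperSubgroup G) ∨
      (p = 3 ∧ ∀ g ∈ G, (g 0 0 + g 1 1) ^ 9 = g 0 0 + g 1 1) := by
  have h2 : (2 : L) ≠ 0 := Ring.two_ne_zero (by rwa [ringChar.eq L p])
  set z : G := ⟨-1, hneg⟩ with hz
  have hzc : ∀ g : G, g * z = z * g := fun g => Subtype.ext (by simp [hz])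
  have hz1 : z ≠ 1 := fun h => neg_one_ne_one h2 (congrArg Subtype.val h)
  have hzz : z * z = 1 := Subtype.ext (by simp [hz])
  have hzX : ∀ x : OnePoint L, z • x = x := neg_one_smul
  have hne1 : ∀ {g : G}, g ≠ 1 → g.1 ≠ 1 := fun hg h => hg (Subtype.ext h)
  have hnez : ∀ {g : G}, g ≠ z → g.1 ≠ -1 := fun hg h => hg (Subtype.ext h)
  have hfix : ∀ g : G, g ≠ 1 → g ≠ z →
      (fixedBy (OnePoint L) g).ncard = 1 ∨ (fixedBy (OnePoint L) g).ncard = 2 :=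
    fun g hg hg' => ncard_fixedBy_eq_one_or_two h2 (hne1 hg) (hnez hg')
  have hupp : (⟨upper 1, h1⟩ : G) ^ p = 1 := Subtype.ext (by
    change upper (1 : L) ^ p = 1
    rw [upper_pow]; simp)
  have hlow : (⟨lower w, hwG⟩ : G) ^ p = 1 := Subtype.ext (by
    change lower w ^ p = 1
    rw [lower_pow]; simp)
  have hupf : fixedBy (OnePoint L) (⟨upper 1, h1⟩ : G) = {∞} := fixedBy_upper one_ne_zero
  have hlof : fixedBy (OnePoint L) (⟨lower w, hwG⟩ : G) = {((0 : L) : OnePoint L)} :=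
    fixedBy_lower hw
  have h0 : (0 : L) ∈ finiteOrbit G := mem_orbit_of_fixedBy_eq_singleton hupp hlow hupf hlof
  have hparorb : ∀ g : G, g ≠ 1 → g ≠ z → (fixedBy (OnePoint L) g).ncard = 1 →
      fixedBy (OnePoint L) g ⊆ orbit G (∞ : OnePoint L) := by
    intro g hg hg' hc
    obtain ⟨x, hx⟩ := Set.ncard_eq_one.1 hc
    -- Up to conjugation g may be minus a transvection; squaring removes the sign and keeps the
    -- fixed point.
    obtain ⟨h3, h4⟩ := sq_of_fixedBy_eq_singleton (p := p) h2 (hne1 hg) (hnez hg') hx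
    rw [hx, Set.singleton_subset_iff]
    have h3' : (g ^ 2) ^ p = 1 := Subtype.ext (by
      rw [Subgroup.coe_pow, Subgroup.coe_pow, h3, Subgroup.coe_one])
    have h4' : fixedBy (OnePoint L) (g ^ 2) =
      fixedBy (OnePoint L) ((g ^ 2 : G) : SpecialLinearGroup (Fin 2) L) := rfl
    rw [Subgroup.coe_pow, h4] at h4'
    exact mem_orbit_of_fixedBy_eq_singleton hupp h3' hupf h4'
  obtain ⟨hSfin, m, hm, hn⟩ := card_orbit_infty G
  obtain ⟨k, hk, hstab⟩ := exists_card_stabilizer_infty h2 hneg h1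
  have hq3 := three_le_card_upperSubgroup h2 h1
  have hqodd := odd_card_upperSubgroup h2 G
  have hpar := card_setOf_ncard_fixedBy_eq_one hzc _ hparorb
  rw [card_fixedBy_eq_one_and_infty h2 hneg] at hpar
  set q := Nat.card (upperSubgroup G) with hq
  have hm1 : 1 ≤ m := by
    rcases Nat.eq_zero_or_pos m with h | h
    · rw [h, zero_mul, Set.ncard_eq_zero hSfin] at hm
      rw [hm] at h0
      exact h0.elim
    · exact h
  have hn3 : 3 ≤ Nat.card (orbit G (∞ : OnePoint L)) := by rw [hn]; nlinarith
  have hup1 : (⟨upper 1, h1⟩ : G) ≠ 1 ∧ (⟨upper 1, h1⟩ : G) ≠ z := by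
    constructor <;> intro h <;>
      simpa [hz] using congrArg (fun g : G => (g : SpecialLinearGroup (Fin 2) L) 0 1) h
  obtain ⟨d, hd2, hd, hstab'⟩ := exists_card_stabilizer_of_notMem_orbit hzc hz1 hzz hzX hfix
    (by omega) ⟨⟨upper 1, h1⟩, hup1.1, hup1.2, upper_smul_infty 1⟩ hn3 hpar hstab
  rw [hn] at hd
  rcases eq_one_or_of_mul_eq hqodd hq3 hm1 hd2 hk hd with rfl | ⟨hq', hm', hk', hd'⟩
  · left
    refine ⟨h0, (Set.eq_of_subset_of_ncard_le ?_ ?_ hSfin).symm⟩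
    · intro a ha
      simpa using add_mem_finiteOrbit ha h0
    · rw [hm, one_mul, hq]; rfl
  · right
    have hp3 : p = 3 := by
      have h3 : Nat.card (upperSubgroup G) • (⟨1, h1⟩ : upperSubgroup G) = 0 := card_nsmul_eq_zero'
      rw [← hq, hq'] at h3
      have h4 : ((3 : ℕ) : L) = 0 := by
        have := congrArg (Subtype.val : upperSubgroup G → L) h3
        simpa using this
      have := (CharP.cast_eq_zero_iff L p 3).1 h4
      exact (Nat.prime_dvd_prime_iff_eq Fact.out Nat.prime_three).1 this
    subst hp3
    refine ⟨rfl, fun g hg => ?_⟩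
    have h3 : (3 : L) = 0 := by simpa using CharP.cast_eq_zero L 3
    by_cases e1 : g = 1
    · subst e1
      simp only [sl2_one_00, sl2_one_11]
      -- 2^9 - 2 = 510 = 170 · 3.
      linear_combination 170 * h3
    by_cases e2 : g = -1
    · subst e2
      simp only [sl2_neg_apply, sl2_one_00, sl2_one_11]
      linear_combination -170 * h3
    obtain ⟨x, hx⟩ := exists_smul_eq_self h2 g
    -- The stabilizers have order 2qk = 12 on the orbit of ∞ and 2d = 10 on the other special orbit.
    have hgpow : g ^ 12 = 1 ∨ g ^ 10 = 1 := by
      have hcard : ∀ N, Nat.card (stabilizer G x) = N → g ^ N = 1 := by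
        rintro N rfl
        have h5 : (⟨⟨g, hg⟩, hx⟩ : stabilizer G x) ^ Nat.card (stabilizer G x) = 1 :=
          pow_card_eq_one'
        exact congrArg (fun u : stabilizer G x => (u.1 : SpecialLinearGroup (Fin 2) L)) h5
      by_cases hxo : x ∈ orbit G (∞ : OnePoint L)
      · left
        apply hcard
        have h5 := card_orbit_mul_card_stabilizer (G := G) x
        rw [orbit_eq_iff.2 hxo, ← card_orbit_mul_card_stabilizer (G := G) (∞ : OnePoint L),
          hstab, hq', hk'] at h5
        exact Nat.eq_of_mul_eq_mul_left (by omega) h5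
      · right
        apply hcard
        rw [hstab' x hxo ⟨⟨g, hg⟩, fun h => e1 (congrArg Subtype.val h),
          fun h => e2 (congrArg Subtype.val h), hx⟩, hd']
    obtain ⟨h, -, hh⟩ := exists_conj_apply_eq_zero hx
    have htr : g 0 0 + g 1 1 = (h⁻¹ * g * h) 0 0 + (h⁻¹ * g * h) 1 1 := by
      have := sl2_det h
      simp only [sl2_mul_apply, sl2_inv_00, sl2_inv_01, sl2_inv_10, sl2_inv_11]
      linear_combination -(g 0 0 + g 1 1) * this
    have hdet := sl2_det (h⁻¹ * g * h)
    rw [hh, mul_zero, sub_zero] at hdet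
    rw [htr]
    exact add_pow_nine hdet (hgpow.imp (fun h5 => conj_apply_00_pow h5 hh)
      fun h5 => conj_apply_00_pow h5 hh)

end Dichotomy

/-! ### A field from Hua's identity -/

section Hua

/-- Hua's identity turns a finite additive group that contains `1` and is stable under
`a ↦ θ / a` into a field. -/
theorem exists_subfield_of_div_mem {L : Type*} [Field L] {p : ℕ} [Fact p.Prime] [CharP L p]
    (hp : p ≠ 2) (A : AddSubgroup L) [Finite A] (h1 : 1 ∈ A) {θ : L} (hθ : θ ≠ 0)
    (hinv : ∀ a ∈ A, θ / a ∈ A) :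
    ∃ R : Subfield L, (∀ a, a ∈ R ↔ a ∈ A) ∧ ∀ a, a ∈ R ↔ θ * a ∈ A := by
  -- Outside the degenerate cases, aba = a - θ/(θ/a + θ/(b⁻¹-a)). The condition on b puts b⁻¹ =
  -- θ/(θb) into A.
  have hua : ∀ a ∈ A, ∀ b, θ * b ∈ A → a * b * a ∈ A := by
    intro a ha b hb
    by_cases ha0 : a = 0
    · simp [ha0]
    by_cases hb0 : b = 0
    · simp [hb0, A.zero_mem]
    by_cases hab : a * b = 1
    · simpa [hab] using ha
    have hb' : b⁻¹ ∈ A := by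
      have := hinv _ hb
      rwa [div_mul_cancel_left₀ hθ] at this
    have hc : b⁻¹ - a ≠ 0 := by
      intro h
      rw [sub_eq_zero] at h
      exact hab (by rw [← h, inv_mul_cancel₀ hb0])
    have he := hinv _ (A.add_mem (hinv _ ha) (hinv _ (A.sub_mem hb' ha)))
    have hab' : 1 - a * b ≠ 0 := fun h => hab (sub_eq_zero.1 h).symm
    have hce : b⁻¹ - a = (1 - a * b) / b := by field_simp
    have hsum : θ / a + θ / (b⁻¹ - a) = θ / (a * (1 - a * b)) := by
      rw [hce]; field_simp; ring
    rw [hsum] at he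
    have : a * b * a = a - θ / (θ / (a * (1 - a * b))) := by
      field_simp; ring
    rw [this]
    exact A.sub_mem ha he
  have hdiv : ∀ b, θ * b ∈ A → b ∈ A := fun b hb => by simpa using hua 1 h1 b hb
  -- Multiplication by θ⁻¹ is an injection of the finite set A into itself, hence onto.
  have hmulθ : ∀ a ∈ A, θ * a ∈ A := by
    let f : A → A := fun a => ⟨θ⁻¹ * a.1, hdiv _ (by rw [mul_inv_cancel_left₀ hθ]; exact a.2)⟩
    have hf : Function.Injective f := fun a b h =>
      Subtype.ext (mul_left_cancel₀ (inv_ne_zero hθ) (congrArg Subtype.val h))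
    intro a ha
    obtain ⟨b, hb⟩ := (Finite.injective_iff_surjective.1 hf) ⟨a, ha⟩
    have hb' : θ⁻¹ * b.1 = a := congrArg Subtype.val hb
    rw [← hb', mul_inv_cancel_left₀ hθ]
    exact b.2
  have hmul : ∀ a ∈ A, ∀ b ∈ A, a * b ∈ A := by
    intro a ha b hb
    have hb' := hmulθ b hb
    -- Polarization of aba in a, at a and 1; the integer (p+1)/2 then undoes the factor 2.
    have h2 : 2 * (a * b) ∈ A := by
      have : 2 * (a * b) = (a + 1) * b * (a + 1) - a * b * a - b := by ring
      rw [this]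
      exact A.sub_mem (A.sub_mem (hua _ (A.add_mem ha h1) b hb') (hua a ha b hb')) hb
    obtain ⟨r, hr⟩ := (Fact.out : p.Prime).odd_of_ne_two hp
    have hr' : (2 * r + 1 : L) = 0 := by
      have := CharP.cast_eq_zero L p
      rw [hr] at this
      exact_mod_cast this
    have : a * b = (r + 1) • (2 * (a * b)) := by
      rw [nsmul_eq_mul]; push_cast
      linear_combination -(a * b) * hr'
    rw [this]
    exact A.nsmul_mem h2 _
  refine ⟨{ A with
    mul_mem' := fun ha hb => hmul _ ha _ hb
    one_mem' := h1
    inv_mem' := fun a ha => hdiv _ ?_ }, fun a => Iff.rfl, fun a => ⟨hmulθ a, hdiv a⟩⟩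
  rw [← div_eq_mul_inv]
  exact hinv a ha

end Hua

/-! ### The subfield in the case m = 1 -/

section OneOrbit

open MulAction Matrix OnePoint

variable {L : Type*} [Field L] [DecidableEq L]

/-- An element J of G that swaps 0 and ∞ acts as a ↦ -b²/a with b = `J 0 1`. This gives the
stability needed for Hua's identity with θ = b², and conjugation by J matches upper with lower
matrices. -/
theorem exists_subfield_of_finiteOrbit_eq {p : ℕ} [Fact p.Prime] [CharP L p] (hp : p ≠ 2)
    {G : Subgroup (SpecialLinearGroup (Fin 2) L)} [Finite G] (h1 : upper 1 ∈ G)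
    (h0 : (0 : L) ∈ finiteOrbit G) (hS : finiteOrbit G = upperSubgroup G) :
    ∃ R : Subfield L, (∀ a, a ∈ R ↔ upper a ∈ G) ∧ ∀ a, a ∈ R ↔ lower a ∈ G := by
  have hmemS : ∀ a, a ∈ upperSubgroup G ↔ (a : OnePoint L) ∈ orbit G (∞ : OnePoint L) := by
    intro a
    rw [← SetLike.mem_coe, ← hS]; rfl
  obtain ⟨J, hJ, hJ00, hJ11⟩ : ∃ J ∈ G, J 0 0 = 0 ∧ J 1 1 = 0 := by
    obtain ⟨g, hg⟩ := h0
    change g.1 • (∞ : OnePoint L) = _ at hg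
    have hdet := sl2_det g.1
    have h10 : g.1 1 0 ≠ 0 := by
      intro h
      rw [sl2_smul_infty, if_pos h] at hg
      exact OnePoint.infty_ne_coe _ hg
    rw [sl2_smul_infty, if_neg h10, OnePoint.coe_eq_coe, div_eq_zero_iff] at hg
    have h00 := hg.resolve_right h10
    -- g maps ∞ to 0. The point that g maps to ∞ is a translation in G; applying that translation
    -- before g also sends 0 to ∞.
    have hy : -g.1 1 1 / g.1 1 0 ∈ upperSubgroup G := by
      rw [hmemS]
      refine ⟨g⁻¹, ?_⟩
      change g⁻¹ • (∞ : OnePoint L) = _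
      rw [inv_smul_eq_iff]
      change _ = g.1 • (((-g.1 1 1 / g.1 1 0 : L)) : OnePoint L)
      rw [sl2_smul_coe, if_pos]
      field_simp
      ring
    refine ⟨g.1 * upper (-g.1 1 1 / g.1 1 0), mul_mem g.2 hy, ?_, ?_⟩
    · simp [sl2_mul_apply, h00]
    · simp only [sl2_mul_apply, upper_01, upper_11]
      field_simp
      ring
  have hdet := sl2_det J
  rw [hJ00, zero_mul, zero_sub] at hdet
  have hb : J 0 1 ≠ 0 := by rintro h; simp [h] at hdet
  have hc : J 1 0 ≠ 0 := by rintro h; simp [h] at hdet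
  have hlow : ∀ a, lower a ∈ G ↔ upper (J 0 1 ^ 2 * a) ∈ G := by
    intro a
    have e : lower a = J * upper (-(J 0 1 ^ 2 * a)) * J⁻¹ := by
      apply sl2_ext <;> simp [sl2_mul_apply, hJ00, hJ11]
      · linear_combination -hdet
      · linear_combination -a * (1 - J 0 1 * J 1 0) * hdet
      · linear_combination -hdet
    constructor
    · intro h
      have e' : upper (-(J 0 1 ^ 2 * a)) = J⁻¹ * lower a * J := by rw [e]; group
      have h' : upper (-(J 0 1 ^ 2 * a)) ∈ G := by
        rw [e']; exact mul_mem (mul_mem (inv_mem hJ) h) hJ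
      have := (upperSubgroup G).neg_mem h'
      rwa [neg_neg] at this
    · intro h
      rw [e]
      exact mul_mem (mul_mem hJ ((upperSubgroup G).neg_mem h)) (inv_mem hJ)
  obtain ⟨R, hR, hR'⟩ := exists_subfield_of_div_mem hp (upperSubgroup G) h1
    (pow_ne_zero 2 hb) (fun a ha => by
      by_cases ha0 : a = 0
      · simp [ha0, zero_mem]
      have h3 : J • (a : OnePoint L) ∈ orbit G (∞ : OnePoint L) :=
        mem_orbit_of_mem_orbit (⟨J, hJ⟩ : G) ((hmemS a).1 ha)
      rw [sl2_smul_coe, hJ00, hJ11, if_neg (by simp [hc, ha0]), ← hmemS] at h3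
      have h4 := neg_mem h3
      have e : J 0 1 ^ 2 / a = -((0 * a + J 0 1) / (J 1 0 * a + 0)) := by
        rw [zero_mul, zero_add, add_zero, ← neg_div, div_eq_div_iff ha0 (mul_ne_zero hc ha0)]
        linear_combination -(J 0 1 * a) * hdet
      rwa [e])
  exact ⟨R, hR, fun a => (hR' a).trans (hlow a).symm⟩

end OneOrbit

/-! ### Generators of SL(2,M) and adjoining -1 -/

section Generation

open Matrix

variable {F : Type*} [Field F]

/-- If the lower left entry is nonzero, the matrix is a product upper · lower · upper over M. If it
is zero, multiplying by `lower 1` replaces it by the lower right entry, which is nonzero. -/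
theorem slSubfield_le {N : Subgroup (SpecialLinearGroup (Fin 2) F)} {M : Subfield F}
    (hu : ∀ a ∈ M, upper a ∈ N) (hl : ∀ a ∈ M, lower a ∈ N) : slSubfield 2 M ≤ N := by
  have key : ∀ h : SpecialLinearGroup (Fin 2) F, h 0 0 ∈ M → h 1 0 ∈ M → h 1 1 ∈ M →
      h 1 0 ≠ 0 → h ∈ N := by
    intro h h00 h10 h11 hc
    have hdet := sl2_det h
    have e : h = upper ((h 0 0 - 1) / h 1 0) * lower (h 1 0) * upper ((h 1 1 - 1) / h 1 0) := by
      apply sl2_ext <;> simp [sl2_mul_apply] <;> field_simp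
      · ring
      · linear_combination -hdet
      · ring
    rw [e]
    exact mul_mem (mul_mem (hu _ (M.div_mem (M.sub_mem h00 M.one_mem) h10)) (hl _ h10))
      (hu _ (M.div_mem (M.sub_mem h11 M.one_mem) h10))
  rintro - ⟨g, rfl⟩
  set h := SpecialLinearGroup.map (n := Fin 2) M.subtype g with hh
  have hM : ∀ i j, h i j ∈ M := fun i j => (g i j).2
  by_cases hc : h 1 0 = 0
  · have hdet := sl2_det h
    have hd : h 1 1 ≠ 0 := by rintro h'; simp [hc, h'] at hdet
    have e : h = (h * lower 1) * lower (-1) := by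
      rw [mul_assoc, lower_mul]; simp
    rw [e]
    refine mul_mem (key _ ?_ ?_ ?_ ?_) (hl _ (M.neg_mem M.one_mem))
    · simpa [sl2_mul_apply] using M.add_mem (hM 0 0) (hM 0 1)
    · simpa [sl2_mul_apply] using M.add_mem (hM 1 0) (hM 1 1)
    · simpa [sl2_mul_apply] using hM 1 1
    · simpa [sl2_mul_apply, hc] using hd
  · exact key h (hM _ _) (hM _ _) (hM _ _) hc

theorem upper_mem_slSubfield {M : Subfield F} {a : F} (ha : a ∈ M) : upper a ∈ slSubfield 2 M :=
  ⟨upper ⟨a, ha⟩, by apply sl2_ext <;> simp [SpecialLinearGroup.map_apply_coe]⟩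

theorem lower_mem_slSubfield {M : Subfield F} {a : F} (ha : a ∈ M) : lower a ∈ slSubfield 2 M :=
  ⟨lower ⟨a, ha⟩, by apply sl2_ext <;> simp [SpecialLinearGroup.map_apply_coe]⟩

/-- The subgroup generated by `G` and `-1`. -/
def adjoinNeg (G : Subgroup (SpecialLinearGroup (Fin 2) F)) :
    Subgroup (SpecialLinearGroup (Fin 2) F) where
  carrier := {g | g ∈ G ∨ -g ∈ G}
  one_mem' := Or.inl G.one_mem
  mul_mem' := by
    rintro a b (ha | ha) (hb | hb)
    · exact Or.inl (mul_mem ha hb)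
    · exact Or.inr (by rw [← mul_neg]; exact mul_mem ha hb)
    · exact Or.inr (by rw [← neg_mul]; exact mul_mem ha hb)
    · exact Or.inl (by rw [← neg_mul_neg]; exact mul_mem ha hb)
  inv_mem' := by
    rintro a (ha | ha)
    · exact Or.inl (inv_mem ha)
    · refine Or.inr ?_
      have e : -a⁻¹ = (-a)⁻¹ := by
        rw [eq_comm, inv_eq_iff_mul_eq_one, neg_mul_neg, mul_inv_cancel]
      rw [e]; exact inv_mem ha

instance finite_adjoinNeg (G : Subgroup (SpecialLinearGroup (Fin 2) F)) [Finite G] :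
    Finite (adjoinNeg G) := by
  have h : (adjoinNeg G : Set (SpecialLinearGroup (Fin 2) F)) ⊆
      (G : Set (SpecialLinearGroup (Fin 2) F)) ∪ Neg.neg '' (G : Set _) := by
    rintro g (hg | hg)
    · exact Or.inl hg
    · exact Or.inr ⟨-g, hg, neg_neg g⟩
  have hG : (G : Set (SpecialLinearGroup (Fin 2) F)).Finite := Set.toFinite _
  exact (hG.union (hG.image _)).subset h

/-- Adjoining `-1` does not give new elements of odd order. -/
theorem mem_of_mem_adjoinNeg {G : Subgroup (SpecialLinearGroup (Fin 2) F)}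
    {g : SpecialLinearGroup (Fin 2) F} {n : ℕ} (hn : Odd n) (hg : g ^ n = 1)
    (h : g ∈ adjoinNeg G) : g ∈ G := by
  rcases h with h | h
  · exact h
  · have h1 := pow_mem h n
    rw [hn.neg_pow, hg] at h1
    have := mul_mem h1 h
    rwa [neg_mul_neg, one_mul] at this

end Generation

/-! ### Dickson's dichotomy over a finite field -/

section FiniteField

open Matrix

variable {F : Type*} [Field F] [Finite F]

/-- The subgroup version of Dickson's theorem: in odd characteristic, the transvections in a
subgroup of `SL(2, F)` that contains `upper 1` and some `lower w` are parametrized by a subfield,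
unless all traces lie in the field with nine elements. -/
theorem exists_subfield_or_trace_pow {p : ℕ} [CharP F p] (hp : p ≠ 2)
    {G : Subgroup (SpecialLinearGroup (Fin 2) F)} (h1 : upper 1 ∈ G)
    {w : F} (hw : w ≠ 0) (hwG : lower w ∈ G) :
    (∃ R : Subfield F, (∀ a, a ∈ R ↔ upper a ∈ G) ∧ ∀ a, a ∈ R ↔ lower a ∈ G) ∨
      (p = 3 ∧ ∀ g ∈ G, (g 0 0 + g 1 1) ^ 9 = g 0 0 + g 1 1) := by
  classical
  have : Fact p.Prime := ⟨CharP.char_is_prime F p⟩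
  have : CharP (AlgebraicClosure F) p := charP_of_injective_algebraMap' F p
  have hodd : Odd p := (Fact.out : p.Prime).odd_of_ne_two hp
  set ι := algebraMap F (AlgebraicClosure F) with hι
  have hιinj : Function.Injective ι := ι.injective
  set φ := SpecialLinearGroup.map (n := Fin 2) ι with hφ
  have happ : ∀ g i j, (φ g) i j = ι (g i j) := fun _ _ _ => rfl
  have hφinj : Function.Injective φ := by
    intro g h hgh
    apply sl2_ext <;> apply hιinj <;> rw [← happ, ← happ, hgh]
  have hup : ∀ a, φ (upper a) = upper (ι a) := by
    intro a; apply sl2_ext <;> simp [happ]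
  have hlo : ∀ a, φ (lower a) = lower (ι a) := by
    intro a; apply sl2_ext <;> simp [happ]
  have : Finite (G.map φ) := by
    have : Finite (SpecialLinearGroup (Fin 2) F) := Subtype.finite
    have h : (G.map φ : Set (SpecialLinearGroup (Fin 2) (AlgebraicClosure F))).Finite := by
      rw [Subgroup.coe_map]; exact (Set.toFinite _).image _
    exact h
  have hupp : ∀ a : AlgebraicClosure F, upper a ^ p = 1 := fun a => by rw [upper_pow]; simp
  have hlop : ∀ a : AlgebraicClosure F, lower a ^ p = 1 := fun a => by rw [lower_pow]; simp
  have hle : G.map φ ≤ adjoinNeg (G.map φ) := fun g hg => Or.inl hg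
  -- These matrices have p-th power 1 with p odd, so adjoining -1 brings in none that were not there
  -- before.
  have hupG : ∀ a, upper (ι a) ∈ adjoinNeg (G.map φ) ↔ upper a ∈ G := by
    intro a
    rw [← Subgroup.mem_map_iff_mem hφinj, hup]
    exact ⟨mem_of_mem_adjoinNeg hodd (hupp _), fun h => hle h⟩
  have hloG : ∀ a, lower (ι a) ∈ adjoinNeg (G.map φ) ↔ lower a ∈ G := by
    intro a
    rw [← Subgroup.mem_map_iff_mem hφinj, hlo]
    exact ⟨mem_of_mem_adjoinNeg hodd (hlop _), fun h => hle h⟩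
  have hneg : -1 ∈ adjoinNeg (G.map φ) := Or.inr (by rw [neg_neg]; exact one_mem _)
  have h1' : upper 1 ∈ adjoinNeg (G.map φ) := by rw [← map_one ι, hupG]; exact h1
  have hw' : lower (ι w) ∈ adjoinNeg (G.map φ) := (hloG w).2 hwG
  have hιw : ι w ≠ 0 := fun h => hw (hιinj (by rw [h, map_zero]))
  rcases finiteOrbit_eq_or hp hneg h1' hιw hw' with ⟨h0, hS⟩ | ⟨hp3, htr⟩
  · left
    obtain ⟨R, hR, hR'⟩ := exists_subfield_of_finiteOrbit_eq hp h1' h0 hS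
    exact ⟨R.comap ι, fun a => by rw [Subfield.mem_comap, hR, hupG],
      fun a => by rw [Subfield.mem_comap, hR', hloG]⟩
  · right
    refine ⟨hp3, fun g hg => hιinj ?_⟩
    have := htr (φ g) (hle (Subgroup.mem_map_of_mem φ hg))
    rw [happ, happ] at this
    rw [map_pow, map_add, this]

/-- In characteristic three, a field of elements with `x ^ 9 = x` is the prime field unless it has
nine elements. -/
theorem eq_of_forall_pow_nine [CharP F 3] {M : Subfield F} (hM : ∀ x ∈ M, x ^ 9 = x)
    (h9 : Nat.card M ≠ 9) : ∀ x ∈ M, x = 0 ∨ x = 1 ∨ x = -1 := by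
  have := Fintype.ofFinite M
  have : CharP M 3 := RingHom.charP (algebraMap M F) (algebraMap M F).injective 3
  obtain ⟨n, -, hn⟩ := FiniteField.card M 3
  -- The units of M are killed by 8, so the power of 3 that is |M| is at most 9.
  have hdvd : Fintype.card M - 1 ∣ 8 := by
    rw [← FiniteField.forall_pow_eq_one_iff]
    intro u
    have h1 : (u : M) ^ 9 = u := Subtype.ext (hM _ (u : M).2)
    have h2 : u ^ 9 = u := Units.ext h1
    have h3 : u ^ 8 * u = 1 * u := by rw [one_mul, ← pow_succ, h2]
    exact mul_right_cancel h3
  rw [Nat.card_eq_fintype_card] at h9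
  have h3 : Fintype.card M = 3 := by
    have hle := Nat.le_of_dvd (by norm_num) hdvd
    rw [hn] at hle h9 ⊢
    have : (n : ℕ) < 3 := by
      by_contra hc
      have : 3 ^ 3 ≤ 3 ^ (n : ℕ) := Nat.pow_le_pow_right (by norm_num) (by omega)
      omega
    have hpos := n.pos
    interval_cases hn' : (n : ℕ)
    · norm_num
    · norm_num at h9
  intro x hx
  have hx3 : (⟨x, hx⟩ : M) ^ 3 = ⟨x, hx⟩ := h3 ▸ FiniteField.pow_card (⟨x, hx⟩ : M)
  have hx3' : x ^ 3 = x := congrArg Subtype.val hx3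
  have : x * ((x - 1) * (x + 1)) = 0 := by linear_combination hx3'
  rcases mul_eq_zero.1 this with h | h
  · exact Or.inl h
  · rcases mul_eq_zero.1 h with h | h
    · exact Or.inr (Or.inl (sub_eq_zero.1 h))
    · exact Or.inr (Or.inr (eq_neg_of_add_eq_zero_left h))

/-- The groups generated by upper unitriangular matrices with entries in `K` and lower unitriangular
matrices with entries in `Λ w`. -/
theorem closure_upper_lower_eq {p : ℕ} [CharP F p] (hp : p ≠ 2) {w : F} (hw : w ≠ 0)
    {K Λ : Set Fˣ} (hK : 1 ∈ K) (hΛ : 1 ∈ Λ) (hM : Nat.card (genSubfield K Λ w) ≠ 9) :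
    Subgroup.closure ((fun c : Fˣ => upper (c : F)) '' K ∪
      (fun c : Fˣ => lower ((c : F) * w)) '' Λ) = slSubfield 2 (genSubfield K Λ w) := by
  set G := Subgroup.closure ((fun c : Fˣ => upper (c : F)) '' K ∪
      (fun c : Fˣ => lower ((c : F) * w)) '' Λ) with hG
  have hKM : ∀ c ∈ K, (c : F) ∈ genSubfield K Λ w := fun c hc =>
    Subfield.subset_closure (Or.inl (Or.inl ⟨c, hc, rfl⟩))
  have hΛM : ∀ c ∈ Λ, (c : F) ∈ genSubfield K Λ w := fun c hc =>
    Subfield.subset_closure (Or.inl (Or.inr ⟨c, hc, rfl⟩))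
  have hwM : w ∈ genSubfield K Λ w := Subfield.subset_closure (Or.inr rfl)
  have hMle : ∀ R : Subfield F, w ∈ R → (∀ c ∈ K, (c : F) ∈ R) → (∀ c ∈ Λ, (c : F) * w ∈ R) →
      genSubfield K Λ w ≤ R := by
    intro R hR1 hR2 hR3
    refine Subfield.closure_le.2 ?_
    rintro x ((⟨c, hc, rfl⟩ | ⟨c, hc, rfl⟩) | rfl)
    · exact hR2 c hc
    · have := R.div_mem (hR3 c hc) hR1
      rwa [mul_div_cancel_right₀ _ hw] at this
    · exact hR1
  have hKG : ∀ c ∈ K, upper (c : F) ∈ G := fun c hc =>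
    Subgroup.subset_closure (Or.inl ⟨c, hc, rfl⟩)
  have hΛG : ∀ c ∈ Λ, lower ((c : F) * w) ∈ G := fun c hc =>
    Subgroup.subset_closure (Or.inr ⟨c, hc, rfl⟩)
  have h1 : upper 1 ∈ G := hKG 1 hK
  have hwG : lower w ∈ G := by simpa using hΛG 1 hΛ
  refine le_antisymm ((Subgroup.closure_le _).2 ?_) ?_
  · rintro - (⟨c, hc, rfl⟩ | ⟨c, hc, rfl⟩)
    · exact upper_mem_slSubfield (hKM c hc)
    · exact lower_mem_slSubfield ((genSubfield K Λ w).mul_mem (hΛM c hc) hwM)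
  rcases exists_subfield_or_trace_pow hp h1 hw hwG with ⟨R, hR, hR'⟩ | ⟨rfl, htr⟩
  · have hle := hMle R ((hR' w).2 hwG) (fun c hc => (hR _).2 (hKG c hc))
      fun c hc => (hR' _).2 (hΛG c hc)
    exact slSubfield_le (fun a ha => (hR a).1 (hle ha)) fun a ha => (hR' a).1 (hle ha)
  · have : Fact (Nat.Prime 3) := ⟨Nat.prime_three⟩
    have h3 : (3 : F) = 0 := by simpa using CharP.cast_eq_zero F 3
    -- The trace of `upper x * lower y` is xy+2, and ninth powers are additive.
    have hfix : ∀ x y, upper x ∈ G → lower y ∈ G → (x * y) ^ 9 = x * y := by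
      intro x y hx hy
      have h := htr _ (mul_mem hx hy)
      simp only [sl2_mul_apply, upper_00, upper_01, upper_10, upper_11, lower_00, lower_01,
        lower_10, lower_11] at h
      have h9 : (x * y + 2) ^ 9 = (x * y) ^ 9 + 2 ^ 9 := add_pow_char_pow (x * y) 2 3 2
      have e : (1 * 1 + x * y + (0 * 0 + 1 * 1) : F) = x * y + 2 := by ring
      rw [e, h9] at h
      linear_combination h - 170 * h3
    let R : Subfield F := (iterateFrobenius F 3 2).eqLocusField (RingHom.id F)
    have hR : ∀ x, x ∈ R ↔ x ^ 9 = x := fun x => by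
      change iterateFrobenius F 3 2 x = x ↔ _
      rw [iterateFrobenius_def]
      norm_num
    have hwR : w ∈ R := (hR w).2 (by simpa using hfix 1 w h1 hwG)
    have hle := hMle R hwR
      (fun c hc => by
        have h := (hR _).2 (hfix _ _ (hKG c hc) hwG)
        have := R.div_mem h hwR
        rwa [mul_div_cancel_right₀ _ hw] at this)
      (fun c hc => (hR _).2 (by simpa using hfix 1 _ h1 (hΛG c hc)))
    have hM3 := eq_of_forall_pow_nine (fun x hx => (hR x).1 (hle hx)) hM
    have hlow : lower 1 ∈ G := by
      rcases hM3 w hwM with h | rfl | rfl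
      · exact (hw h).elim
      · exact hwG
      · have := inv_mem hwG
        rwa [lower_inv, neg_neg] at this
    refine slSubfield_le (fun a ha => ?_) fun a ha => ?_
    · rcases hM3 a ha with rfl | rfl | rfl
      · rw [upper_zero]; exact one_mem _
      · exact h1
      · rw [← upper_inv]; exact inv_mem h1
    · rcases hM3 a ha with rfl | rfl | rfl
      · rw [lower_zero]; exact one_mem _
      · exact hlow
      · rw [← lower_inv]; exact inv_mem hlow

end FiniteField

open Module

/-! ### Splitting off the plane -/

section Decomposition

variable {F V : Type*} [Field F] [AddCommGroup V] [Module F V]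

/-- `g` acts on the plane `U` by the matrix `h` in the basis `b`, and trivially on `W`. -/
def ActsBy {U : Submodule F V} (W : Submodule F V) (b : Basis (Fin 2) F U)
    (g : SpecialLinearGroup F V) (h : Matrix.SpecialLinearGroup (Fin 2) F) : Prop :=
  (∀ u : U, g.1 (u : V) = ((Matrix.SpecialLinearGroup.toLin_equiv b h).1 u : V)) ∧
    ∀ x ∈ W, g.1 x = x

variable {U W : Submodule F V} {b : Basis (Fin 2) F U}

theorem toLin_equiv_apply (h : Matrix.SpecialLinearGroup (Fin 2) F) (j : Fin 2) :
    (((Matrix.SpecialLinearGroup.toLin_equiv b h).1 (b j) : U) : V) =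
      h 0 j • (b 0 : V) + h 1 j • (b 1 : V) := by
  have h1 : (Matrix.SpecialLinearGroup.toLin_equiv b h).1 (b j) = Matrix.toLin b b h.1 (b j) := rfl
  rw [h1, Matrix.toLin_self, Fin.sum_univ_two]
  rfl

theorem actsBy_of_apply {g : SpecialLinearGroup F V} {h : Matrix.SpecialLinearGroup (Fin 2) F}
    (hb : ∀ j, g.1 (b j : V) = h 0 j • (b 0 : V) + h 1 j • (b 1 : V)) (hW : ∀ x ∈ W, g.1 x = x) :
    ActsBy W b g h := by
  refine ⟨fun u => ?_, hW⟩
  have : g.1.toLinearMap ∘ₗ U.subtype =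
      U.subtype ∘ₗ (Matrix.SpecialLinearGroup.toLin_equiv b h).1.toLinearMap :=
    b.ext fun j => (hb j).trans (toLin_equiv_apply h j).symm
  exact LinearMap.congr_fun this u

theorem ActsBy.mem_sumOne {g : SpecialLinearGroup F V}
    {h : Matrix.SpecialLinearGroup (Fin 2) F} (hg : ActsBy W b g h)
    {N : Subgroup (Matrix.SpecialLinearGroup (Fin 2) F)} (hN : h ∈ N) :
    g ∈ sumOne U W (N.map (Matrix.SpecialLinearGroup.toLin_equiv b).toMonoidHom) :=
  ⟨⟨_, Subgroup.mem_map_of_mem _ hN, hg.1⟩, hg.2⟩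

theorem ActsBy.eq (hUW : IsCompl U W) {g g' : SpecialLinearGroup F V}
    {h : Matrix.SpecialLinearGroup (Fin 2) F} (hg : ActsBy W b g h) (hg' : ActsBy W b g' h) :
    g = g' := by
  refine Subtype.ext (LinearEquiv.ext fun x => ?_)
  obtain ⟨u, hu, y, hy, rfl⟩ := Submodule.mem_sup.1
    (hUW.sup_eq_top ▸ Submodule.mem_top : x ∈ U ⊔ W)
  rw [map_add, map_add, hg.2 y hy, hg'.2 y hy]
  have h1 := hg.1 ⟨u, hu⟩
  have h2 := hg'.1 ⟨u, hu⟩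
  rw [← h2] at h1
  exact congrArg (· + y) h1

theorem ActsBy.mul {g g' : SpecialLinearGroup F V}
    {h h' : Matrix.SpecialLinearGroup (Fin 2) F} (hg : ActsBy W b g h) (hg' : ActsBy W b g' h') :
    ActsBy W b (g * g') (h * h') := by
  refine ⟨fun u => ?_, fun x hx => ?_⟩
  · rw [map_mul]
    change g.1 (g'.1 u) = (((Matrix.SpecialLinearGroup.toLin_equiv b h).1
      ((Matrix.SpecialLinearGroup.toLin_equiv b h').1 u) : U) : V)
    rw [hg'.1, hg.1]
  · change g.1 (g'.1 x) = x
    rw [hg'.2 x hx, hg.2 x hx]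

theorem ActsBy.inv {g : SpecialLinearGroup F V}
    {h : Matrix.SpecialLinearGroup (Fin 2) F} (hg : ActsBy W b g h) :
    ActsBy W b g⁻¹ h⁻¹ := by
  refine ⟨fun u => ?_, fun x hx => ?_⟩
  · rw [map_inv]
    change g.1.symm (u : V) = (((Matrix.SpecialLinearGroup.toLin_equiv b h).1.symm u : U) : V)
    rw [LinearEquiv.symm_apply_eq, hg.1, LinearEquiv.apply_symm_apply]
  · change g.1.symm x = x
    rw [LinearEquiv.symm_apply_eq, hg.2 x hx]

theorem actsBy_one : ActsBy W b 1 1 := by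
  refine ⟨fun u => ?_, fun x _ => rfl⟩
  rw [map_one]; rfl

/-- Every product of elements of T lifts to one of elements of S, and an element of SL(V) is
determined by its matrix on U and its triviality on W. -/
theorem sumOne_map_closure (hUW : IsCompl U W) {S : Set (SpecialLinearGroup F V)}
    {T : Set (Matrix.SpecialLinearGroup (Fin 2) F)}
    (hS : ∀ g ∈ S, ∃ h ∈ T, ActsBy W b g h) (hT : ∀ h ∈ T, ∃ g ∈ S, ActsBy W b g h) :
    Subgroup.closure S = sumOne U W
      ((Subgroup.closure T).map (Matrix.SpecialLinearGroup.toLin_equiv b).toMonoidHom) := by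
  refine le_antisymm ((Subgroup.closure_le _).2 fun g hg => ?_) ?_
  · obtain ⟨h, hh, hgh⟩ := hS g hg
    exact hgh.mem_sumOne (Subgroup.subset_closure hh)
  · have key : ∀ h ∈ Subgroup.closure T, ∃ g ∈ Subgroup.closure S, ActsBy W b g h := by
      intro h hh
      induction hh using Subgroup.closure_induction with
      | mem h hh =>
        obtain ⟨g, hg, hgh⟩ := hT h hh
        exact ⟨g, Subgroup.subset_closure hg, hgh⟩
      | one => exact ⟨1, one_mem _, actsBy_one⟩
      | mul h h' _ _ ih ih' =>
        obtain ⟨g, hg, hgh⟩ := ih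
        obtain ⟨g', hg', hgh'⟩ := ih'
        exact ⟨g * g', mul_mem hg hg', hgh.mul hgh'⟩
      | inv h _ ih =>
        obtain ⟨g, hg, hgh⟩ := ih
        exact ⟨g⁻¹, inv_mem hg, hgh.inv⟩
    rintro g ⟨⟨-, ⟨h, hh, rfl⟩, hgU⟩, hgW⟩
    obtain ⟨g', hg', hgh'⟩ := key h hh
    rwa [ActsBy.eq hUW (⟨hgU, hgW⟩ : ActsBy W b g h) hgh']

/-- Two vectors `u`, `v` and two forms with `φ u = 0`, `φ v = 1`, `ψ u ≠ 0`, `ψ v = 0` split off a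
plane. -/
theorem exists_isCompl_basis {u v : V} {φ ψ : Dual F V} (hφu : φ u = 0) (hφv : φ v = 1)
    (hψu : ψ u ≠ 0) (hψv : ψ v = 0) :
    ∃ U : Submodule F V, IsCompl U (LinearMap.ker φ ⊓ LinearMap.ker ψ) ∧
      ∃ b : Basis (Fin 2) F U, (b 0 : V) = u ∧ (b 1 : V) = v := by
  have hli : LinearIndependent F ![u, v] := by
    rw [LinearIndependent.pair_iff]
    intro c d h
    have h1 := congrArg φ h
    have h2 := congrArg ψ h
    simp only [map_add, map_smul, smul_eq_mul, map_zero, hφu, hφv, hψv] at h1 h2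
    have h2' : c * ψ u = 0 := by linear_combination h2
    exact ⟨(mul_eq_zero.1 h2').resolve_right hψu, by linear_combination h1⟩
  refine ⟨Submodule.span F (Set.range ![u, v]), ⟨?_, ?_⟩, Basis.span hli, ?_, ?_⟩
  · rw [Submodule.disjoint_def]
    intro x hx hx'
    rw [Matrix.range_cons, Matrix.range_cons, Matrix.range_empty, Set.union_empty,
      Set.singleton_union, Submodule.mem_span_pair] at hx
    obtain ⟨c, d, rfl⟩ := hx
    have h1 := LinearMap.mem_ker.1 hx'.1
    have h2 := LinearMap.mem_ker.1 hx'.2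
    simp only [map_add, map_smul, smul_eq_mul, hφu, hφv, hψv] at h1 h2
    have h2' : c * ψ u = 0 := by linear_combination h2
    have hd : d = 0 := by linear_combination h1
    rw [(mul_eq_zero.1 h2').resolve_right hψu, hd]
    simp
  · rw [codisjoint_iff, Submodule.eq_top_iff']
    intro x
    have hu : u ∈ Submodule.span F (Set.range ![u, v]) := Submodule.subset_span ⟨0, rfl⟩
    have hv : v ∈ Submodule.span F (Set.range ![u, v]) := Submodule.subset_span ⟨1, rfl⟩
    -- The forms read off the plane component: φ detects only v, with φ v = 1, and ψ only u.
    refine Submodule.mem_sup.2 ⟨(ψ x / ψ u) • u + φ x • v, Submodule.add_mem _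
      (Submodule.smul_mem _ _ hu) (Submodule.smul_mem _ _ hv),
      x - ((ψ x / ψ u) • u + φ x • v), ⟨?_, ?_⟩, by abel⟩
    · simp [hφu, hφv]
    · simp [hψv, hψu]
  · rw [Basis.span_apply]; rfl
  · rw [Basis.span_apply]; rfl

end Decomposition

end TransvectionGraph

theorem theorem3p4 {F V : Type*} [Field F] [Finite F] (p : ℕ) [CharP F p]
    [AddCommGroup V] [Module F V] [FiniteDimensional F V]
    (s t : TransvectionGraph.transvections F V) (hst : TransvectionGraph.IsTwoWayEdge s t)
    (K Λ : Set Fˣ) (hK : 1 ∈ K) (hΛ : 1 ∈ Λ)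
    (hp : p ≠ 2) (hM : Nat.card (TransvectionGraph.genSubfield K Λ (TransvectionGraph.weight s t)) ≠ 9) :
    TransvectionGraph.IsSumOne 2 (Subgroup.closure (TransvectionGraph.scalarPowSet s K ∪ TransvectionGraph.scalarPowSet t Λ))
      (TransvectionGraph.slSubfield 2 (TransvectionGraph.genSubfield K Λ (TransvectionGraph.weight s t))) := by
  open TransvectionGraph in
  obtain ⟨hψu, hφv⟩ : form t (vec s) ≠ 0 ∧ form s (vec t) ≠ 0 := hst
  have hw : weight s t ≠ 0 := mul_ne_zero hψu hφv
  have hwdef : weight s t = form t (vec s) * form s (vec t) := rfl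
  -- Rescaling the second vector to have value 1 under the form of s turns s^c into `upper c` and
  -- moves the whole weight into the lower entry of t^c.
  obtain ⟨U, hUW, b, hb0, hb1⟩ := exists_isCompl_basis (u := vec s)
    (v := (form s (vec t))⁻¹ • vec t) (form_vec s) (by simp [hφv]) hψu (by simp [form_vec])
  have hsact : ∀ c : F, ActsBy (LinearMap.ker (form s) ⊓ LinearMap.ker (form t)) b
      (scalarPow s c) (upper c) := by
    intro c
    refine actsBy_of_apply (Fin.forall_fin_two.2 ⟨?_, ?_⟩) fun x hx => ?_
    · rw [hb0, hb1, scalarPow_apply s (coe_eq s), form_vec]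
      simp
    · rw [hb0, hb1, scalarPow_apply s (coe_eq s)]
      simp [hφv, add_comm]
    · rw [scalarPow_apply s (coe_eq s), LinearMap.mem_ker.1 hx.1]
      simp
  have htact : ∀ c : F, ActsBy (LinearMap.ker (form s) ⊓ LinearMap.ker (form t)) b
      (scalarPow t c) (lower (c * weight s t)) := by
    intro c
    refine actsBy_of_apply (Fin.forall_fin_two.2 ⟨?_, ?_⟩) fun x hx => ?_
    · rw [hb0, hb1, scalarPow_apply t (coe_eq t), lower_00, lower_10, one_smul, smul_smul,
        smul_smul, hwdef]
      congr 2
      field_simp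
    · rw [hb0, hb1, scalarPow_apply t (coe_eq t)]
      simp [form_vec]
    · rw [scalarPow_apply t (coe_eq t), LinearMap.mem_ker.1 hx.2]
      simp
  have hclosure := closure_upper_lower_eq hp hw hK hΛ hM
  refine ⟨U, _, hUW, by rw [Module.finrank_eq_card_basis b, Fintype.card_fin],
    (slSubfield 2 (genSubfield K Λ (weight s t))).map
      (Matrix.SpecialLinearGroup.toLin_equiv b).toMonoidHom, ?_, b, ?_⟩
  · rw [← hclosure]
    apply sumOne_map_closure hUW
    · rintro - (⟨c, hc, rfl⟩ | ⟨c, hc, rfl⟩)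
      · exact ⟨_, Or.inl ⟨c, hc, rfl⟩, hsact c⟩
      · exact ⟨_, Or.inr ⟨c, hc, rfl⟩, htact c⟩
    · rintro - (⟨c, hc, rfl⟩ | ⟨c, hc, rfl⟩)
      · exact ⟨_, Or.inl ⟨c, hc, rfl⟩, hsact c⟩
      · exact ⟨_, Or.inr ⟨c, hc, rfl⟩, htact c⟩
  · ext x
    simp [Subgroup.mem_map]
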